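/- Let $N\ge 1$, $s\in(0,1)$, and let $a:\mathbb R^N\times\mathbb R^N\times(0,\infty)\to[0,\infty)$. Put $g(x,y,t)=a(x,y,t)\,t$ for $t>0$, $g(x,y,0)=0$, $G_{x,y}(t)=\int_0^t g(x,y,\tau)\,d\tau$ for $t\ge 0$, and $\widehat G_x=G_{x,x}$. Assume that $(x,y,t)\mapsto G_{x,y}(t)$ is a Carathéodory function and that, for all $x,y,z\in\mathbb R^N$: - $(g_1)$ $a(x,y,t)t\to 0$ as $t\to0^+$ and $a(x,y,t)t\to+\infty$ as $t\to+\infty$; - $(g_2)$ $t\mapsto a(x,y,t)$ is continuous on $(0,\infty)$; - $(g_3)$ $t\mapsto a(x,y,t)t$ is increasing on $(0,\infty)$; - $(g_4)$ there are constants $1<g^-\le g^+<\infty$, independent of $x,y$, with $g^-\le \dfrac{a(x,y,t)t^2}{G_{x,y}(t)}\le g^+$ for all $t>0$; - $(H_1)$ for every $c>0$ and every compact $A\subset\mathbb R^N$, $\int_{A\times A}G_{x,y}(c)\,dx\,dy<\infty$ and $\int_A\widehat G_x(c)\,dx<\infty$; - $(H_2)$ $G_{x-z,y-z}(t)=G_{x,y}(t)$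 for all $t\ge0$; - $(\mathcal B_f)$ there are constants $C_1,C_2>0$, independent of $x,y$, with $C_1\le G_{x,y}(1)\le C_2$. For measurable $u:\mathbb R^N\to\mathbb R$ let $$J(u)=\int_{\mathbb R^N}\widehat G_x(|u(x)|)\,dx,\qquad J_s(u)=\int_{\mathbb R^N}\int_{\mathbb R^N}G_{x,y}\!\left(\frac{|u(x)-u(y)|}{|x-y|^s}\right)\frac{dx\,dy}{|x-y|^N}.$$ Let $W^{s,G_{x,y}}(\mathbb R^N)$ be the set of measurable $u$ with $J(\lambda u)<\infty$ and $J_s(\lambda' u)<\infty$ for some $\lambda,\lambda'>0$, with the norm $$\|u\|=\inf\{\lambda>0:J(u/\lambda)\le1\}+\inf\{\lambda>0:J_s(u/\lambda)\le1\},$$ and let $W_0^{s,G_{x,y}}(\Omega)=\{u\in W^{s,G_{x,y}}(\mathbb R^N):u=0\text{ a.e. in }\mathbb R^N\setminus\Omega\}$. Let $\Omega\subseteq\mathbb R^N$ be open with continuous boundary, i.e. $\partial\Omega$ is compact and there are $M\in\mathbb N$, open sets $W_1,\dots,W_M\subseteq\mathbb R^N$, sets $\Omega_1,\dots,\Omega_M\subseteq\mathbb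 R^N$, continuous functions $\xi_1,\dots,\xi_M:\mathbb R^{N-1}\to\mathbb R$ and rigid motions $\mathscr R_1,\dots,\mathscr R_M$ of $\mathbb R^N$ such that $\partial\Omega\subseteq\bigcup_jW_j$ and, for each $j$, $\mathscr R_j(\Omega_j)=\{(x',x_N)\in\mathbb R^{N-1}\times\mathbb R:x_N<\xi_j(x')\}$ and $W_j\cap\Omega=W_j\cap\Omega_j$. Then the space $C_0^\infty(\Omega)$ of $C^\infty$ functions on $\mathbb R^N$ with compact support contained in $\Omega$ is dense in $W_0^{s,G_{x,y}}(\Omega)$: it is contained in $W_0^{s,G_{x,y}}(\Omega)$, and for every $u\in W_0^{s,G_{x,y}}(\Omega)$ and $\varepsilon>0$ there is $\varphi\in C_0^\infty(\Omega)$ with $\|u-\varphi\|<\varepsilon$. -/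

import Mathlib

open MeasureTheory Filter Topology Set
open scoped ContDiff ENNReal

noncomputable section

namespace MusielakSobolev

/-- The Euclidean space `ℝ^N` with `N = n + 1 ≥ 1`. -/
abbrev E (n : ℕ) : Type := EuclideanSpace ℝ (Fin (n + 1))

/-! ### The generating functions `a`, `g`, `G`, and the hypotheses on them -/

/-- `g(x, y, t) = a(x, y, t) t` for `t ≠ 0` and `g(x, y, 0) = 0`. -/
def gFun {n : ℕ} (a : E n → E n → ℝ → ℝ) (x y : E n) (t : ℝ) : ℝ :=
  if t = 0 then 0 else a x y t * t

/-- `G_{x,y}(t) = ∫_0^t g(x, y, τ) dτ` (used for `t ≥ 0`). -/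
def G {n : ℕ} (a : E n → E n → ℝ → ℝ) (x y : E n) (t : ℝ) : ℝ :=
  ∫ τ in (0 : ℝ)..t, gFun a x y τ

/-- `Ĝ_x(t) = G_{x,x}(t)`. -/
def Ghat {n : ℕ} (a : E n → E n → ℝ → ℝ) (x : E n) (t : ℝ) : ℝ := G a x x t

/-- `a` takes nonnegative values on `(0, ∞)`. -/
def Nonneg {n : ℕ} (a : E n → E n → ℝ → ℝ) : Prop :=
  ∀ x y, ∀ t : ℝ, 0 < t → 0 ≤ a x y t

/-- `G` is a Carathéodory function: Lebesgue measurable in `(x, y)` for each `t ≥ 0`, and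
continuous in `t ∈ [0, ∞)` for almost every `(x, y)`. -/
def Caratheodory {n : ℕ} (a : E n → E n → ℝ → ℝ) : Prop :=
  (∀ t : ℝ, 0 ≤ t → AEMeasurable (fun p : E n × E n => G a p.1 p.2 t) volume) ∧
  ∀ᵐ p : E n × E n, ContinuousOn (G a p.1 p.2) (Ici 0)

/-- `(g₁)`. -/
def CondG1 {n : ℕ} (a : E n → E n → ℝ → ℝ) : Prop :=
  ∀ x y, Tendsto (fun t => a x y t * t) (𝓝[>] 0) (𝓝 0) ∧
    Tendsto (fun t => a x y t * t) atTop atTop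

/-- `(g₂)`. -/
def CondG2 {n : ℕ} (a : E n → E n → ℝ → ℝ) : Prop :=
  ∀ x y, ContinuousOn (a x y) (Ioi 0)

/-- `(g₃)`: `t ↦ a(x, y, t) t` is (weakly) increasing on `(0, ∞)`. -/
def CondG3 {n : ℕ} (a : E n → E n → ℝ → ℝ) : Prop :=
  ∀ x y, MonotoneOn (fun t => a x y t * t) (Ioi 0)

/-- `(g₄)`. The bound below by `gm > 1` forces `G_{x,y}(t) ≠ 0`. -/
def CondG4 {n : ℕ} (a : E n → E n → ℝ → ℝ) : Prop :=
  ∃ gm gp : ℝ, 1 < gm ∧ ∀ x y, ∀ t : ℝ, 0 < t →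
    gm ≤ a x y t * t ^ 2 / G a x y t ∧ a x y t * t ^ 2 / G a x y t ≤ gp

/-- `(H₁)`: local integrability of `G_{x,y}` and `Ĝ_x`. -/
def CondH1 {n : ℕ} (a : E n → E n → ℝ → ℝ) : Prop :=
  ∀ c : ℝ, 0 < c → ∀ A : Set (E n), IsCompact A →
    ∫⁻ p in A ×ˢ A, ENNReal.ofReal (G a p.1 p.2 c) < ⊤ ∧
    ∫⁻ x in A, ENNReal.ofReal (Ghat a x c) < ⊤

/-- `(H₂)`: invariance under simultaneous translation. -/
def CondH2 {n : ℕ} (a : E n → E n → ℝ → ℝ) : Prop :=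
  ∀ x y z : E n, ∀ t : ℝ, 0 ≤ t → G a (x - z) (y - z) t = G a x y t

/-- The fractional boundedness condition `G_{x,y} ∈ 𝓑_f`. -/
def CondBf {n : ℕ} (a : E n → E n → ℝ → ℝ) : Prop :=
  ∃ C₁ C₂ : ℝ, 0 < C₁ ∧ 0 < C₂ ∧ ∀ x y, C₁ ≤ G a x y 1 ∧ G a x y 1 ≤ C₂

/-! ### The fractional Musielak–Sobolev space on `ℝ^N` -/

/-- The modular `J_{Ĝ_x}(u) = ∫ Ĝ_x(|u(x)|) dx`. -/
def modular {n : ℕ} (a : E n → E n → ℝ → ℝ) (u : E n → ℝ) : ℝ≥0∞ :=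
  ∫⁻ x, ENNReal.ofReal (Ghat a x |u x|)

/-- The modular `J_{s,G}(u) = ∬ G_{x,y}(|u(x) - u(y)| / |x - y|^s) dx dy / |x - y|^N`.
The diagonal is a null set (and the integrand vanishes there). -/
def fracModular {n : ℕ} (a : E n → E n → ℝ → ℝ) (s : ℝ) (u : E n → ℝ) : ℝ≥0∞ :=
  ∫⁻ p : E n × E n,
    ENNReal.ofReal (G a p.1 p.2 (|u p.1 - u p.2| / ‖p.1 - p.2‖ ^ s) / ‖p.1 - p.2‖ ^ (n + 1))

/-- The Luxemburg functional `inf {lam > 0 : J(u / lam) ≤ 1}` of a modular `J`, with values in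
`[0, ∞]` (it is `∞` when there is no such `lam`). -/
def luxemburg {n : ℕ} (J : (E n → ℝ) → ℝ≥0∞) (u : E n → ℝ) : ℝ≥0∞ :=
  ⨅ (lam : ℝ) (_ : 0 < lam ∧ J (fun x => u x / lam) ≤ 1), ENNReal.ofReal lam

/-- The norm `‖u‖_{L^{Ĝ_x}(ℝ^N)} + [u]_{s,G_{x,y}}` of `W^{s,G_{x,y}}(ℝ^N)`. -/
def sobolevNorm {n : ℕ} (a : E n → E n → ℝ → ℝ) (s : ℝ) (u : E n → ℝ) : ℝ≥0∞ :=
  luxemburg (modular a) u + luxemburg (fracModular a s) u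

/-- The Musielak–Orlicz space `L^{Ĝ_x}(ℝ^N)`, as a set of (Lebesgue measurable) functions. -/
def LSpace {n : ℕ} (a : E n → E n → ℝ → ℝ) : Set (E n → ℝ) :=
  {u | AEMeasurable u volume ∧ ∃ lam : ℝ, 0 < lam ∧ modular a (fun x => lam * u x) < ⊤}

/-- The fractional Musielak–Sobolev space `W^{s,G_{x,y}}(ℝ^N)`. -/
def WSpace {n : ℕ} (a : E n → E n → ℝ → ℝ) (s : ℝ) : Set (E n → ℝ) :=
  {u | u ∈ LSpace a ∧ ∃ lam : ℝ, 0 < lam ∧ fracModular a s (fun x => lam * u x) < ⊤}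

/-- `W_0^{s,G_{x,y}}(Ω)`: the functions of `W^{s,G_{x,y}}(ℝ^N)` that vanish a.e. outside `Ω`. -/
def W0Space {n : ℕ} (a : E n → E n → ℝ → ℝ) (s : ℝ) (Ω : Set (E n)) : Set (E n → ℝ) :=
  {u | u ∈ WSpace a s ∧ ∀ᵐ x : E n, x ∉ Ω → u x = 0}

/-- `C_0^∞(Ω)`: smooth functions on `ℝ^N` with compact support contained in `Ω`. -/
def CcInfty {n : ℕ} (Ω : Set (E n)) : Set (E n → ℝ) :=
  {φ | ContDiff ℝ ∞ φ ∧ HasCompactSupport φ ∧ tsupport φ ⊆ Ω}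

/-! ### Open sets with continuous boundary -/

/-- `{(x', x_N) ∈ ℝ^{N-1} × ℝ : x_N < ξ(x')}`, where `N = n + 1`. -/
def hypograph {n : ℕ} (ξ : EuclideanSpace ℝ (Fin n) → ℝ) : Set (E n) :=
  {x | x (Fin.last n) < ξ (WithLp.toLp 2 fun i : Fin n => x i.castSucc)}

/-- `Ω` has a compact continuous boundary: near each boundary point it is, up to a rigid motion,
the hypograph of a continuous function, with finitely many pieces. -/
def HasContinuousBoundary {n : ℕ} (Ω : Set (E n)) : Prop :=
  IsCompact (frontier Ω) ∧
  ∃ (M : ℕ) (W Ωl : Fin M → Set (E n)) (ξ : Fin M → EuclideanSpace ℝ (Fin n) → ℝ)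
    (R : Fin M → (E n ≃ᵃⁱ[ℝ] E n)),
    (∀ j, IsOpen (W j)) ∧ (∀ j, Continuous (ξ j)) ∧
    frontier Ω ⊆ ⋃ j, W j ∧
    (∀ j, R j '' Ωl j = hypograph (ξ j)) ∧
    (∀ j, W j ∩ Ω = W j ∩ Ωl j)

end MusielakSobolev

end

open scoped NNReal

namespace MusielakSobolev

/-! ### Young functions given by a monotone density -/

section Young

variable {g : ℝ → ℝ}

/-! By $(H_2)$, $G_{x,y}=G_{x-y,0}$. With $z=x-y$ the fractional modular becomes $\int dz\int
P_z(v(y+z)-v(y))\,dy$, where $P_z(t)=G_{z,0}(|t|/|z|^s)/|z|^N$, and the other modular becomes $\int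
Q(v)$ with $Q=G_{0,0}(|\cdot|)$. Each $P_z$ is even and convex, and the inner integral is invariant
under translation of $v$. By Jensen's inequality, averaging translates of $v$ therefore does not
increase it (`IsGagliardoKernel.incrementModular_average_le`). The bound $g^+$ gives polynomial
growth under scaling, so smallness in norm follows from smallness of the energy, which is the sum of
the two modulars.

The bound on $G_{z,0}(1)$ and convexity make $G_{z,0}$ at most linear on bounded intervals,
uniformly in $z$. Increments of size $\min(1,|z|)$ then cost at most a weight which is integrable
because $0<s<1$. Convergence of the energy thus reduces, for uniformly bounded functions, to $L^1$
convergence together with one integrable bound in $z$ on the increment modulars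
(`tendsto_energy_of_dominated`).

Truncating the values and then cutting off at infinity leaves a bounded integrable $u$ that vanishes
outside a compact set. Lipschitz cutoffs near the compact boundary split it into one piece vanishing
near $\partial\Omega$ and finitely many pieces each living in one chart. There $\Omega$ is a
hypograph, so an arbitrarily small downward translation pushes the closed support into $\Omega$. A
mollifier centred at the translation vector moves and smooths the piece at once
(`IsAdmissible.isSmoothLimit_of_translate`), and `IsAdmissible.isSmoothLimit_of_finite_cover`
reassembles the pieces. -/

theorem intervalIntegrable_of_monotoneOn_Ici (hmono : MonotoneOn g (Ici 0)) {t t' : ℝ}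
    (ht : 0 ≤ t) (ht' : 0 ≤ t') : IntervalIntegrable g volume t t' :=
  (hmono.mono fun _ hx => le_trans (le_min ht ht') hx.1).intervalIntegrable

theorem hasDerivAt_integral_of_monotoneOn (hmono : MonotoneOn g (Ici 0))
    (hcont : ContinuousOn g (Ioi 0)) {t : ℝ} (ht : 0 < t) :
    HasDerivAt (fun r => ∫ τ in (0 : ℝ)..r, g τ) (g t) t :=
  intervalIntegral.integral_hasDerivAt_right
    (intervalIntegrable_of_monotoneOn_Ici hmono le_rfl ht.le)
    (hcont.stronglyMeasurableAtFilter isOpen_Ioi t ht)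
    (hcont.continuousAt (Ioi_mem_nhds ht))

theorem integral_nonneg_of_monotoneOn (hmono : MonotoneOn g (Ici 0)) (h0 : g 0 = 0)
    {t : ℝ} (ht : 0 ≤ t) : 0 ≤ ∫ τ in (0 : ℝ)..t, g τ :=
  intervalIntegral.integral_nonneg ht fun _ hτ =>
    h0 ▸ hmono (mem_Ici.2 le_rfl) (mem_Ici.2 hτ.1) hτ.1

theorem integral_mono_of_monotoneOn (hmono : MonotoneOn g (Ici 0)) (h0 : g 0 = 0) :
    MonotoneOn (fun r => ∫ τ in (0 : ℝ)..r, g τ) (Ici 0) := by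
  intro t ht t' ht' htt'
  have h := intervalIntegral.integral_add_adjacent_intervals
    (intervalIntegrable_of_monotoneOn_Ici hmono le_rfl ht)
    (intervalIntegrable_of_monotoneOn_Ici hmono ht ht')
  have h2 : 0 ≤ ∫ τ in t..t', g τ := intervalIntegral.integral_nonneg htt' fun τ hτ =>
    h0 ▸ hmono (mem_Ici.2 le_rfl) (mem_Ici.2 (le_trans ht hτ.1)) (le_trans ht hτ.1)
  simp only
  linarith

theorem continuousOn_integral_of_monotoneOn (hmono : MonotoneOn g (Ici 0)) :
    ContinuousOn (fun r => ∫ τ in (0 : ℝ)..r, g τ) (Ici 0) := by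
  intro t ht
  have ht : (0 : ℝ) ≤ t := ht
  have h := intervalIntegral.continuousOn_primitive_interval'
    (intervalIntegrable_of_monotoneOn_Ici hmono le_rfl (show (0 : ℝ) ≤ t + 1 by linarith))
    (left_mem_uIcc (a := (0 : ℝ)) (b := t + 1))
  rw [uIcc_of_le (by linarith)] at h
  refine (h t ⟨ht, by linarith⟩).mono_of_mem_nhdsWithin ?_
  rw [← Ici_inter_Iic]
  exact inter_mem self_mem_nhdsWithin (mem_nhdsWithin_of_mem_nhds (Iic_mem_nhds (by linarith)))

theorem convexOn_integral_of_monotoneOn (hmono : MonotoneOn g (Ici 0))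
    (hcont : ContinuousOn g (Ioi 0)) :
    ConvexOn ℝ (Ici 0) (fun r => ∫ τ in (0 : ℝ)..r, g τ) := by
  refine MonotoneOn.convexOn_of_deriv (convex_Ici 0) (continuousOn_integral_of_monotoneOn hmono)
    ?_ ?_
  · rw [interior_Ici]
    exact fun t ht => (hasDerivAt_integral_of_monotoneOn hmono hcont
      ht).differentiableAt.differentiableWithinAt
  · rw [interior_Ici]
    intro t ht t' ht' htt'
    rw [(hasDerivAt_integral_of_monotoneOn hmono hcont ht).deriv,
      (hasDerivAt_integral_of_monotoneOn hmono hcont ht').deriv]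
    exact hmono (mem_Ici.2 (le_of_lt ht)) (mem_Ici.2 (le_of_lt ht')) htt'

/-- Under the growth condition `t g(t) ≤ m ∫₀ᵗ g`, the quotient of `∫₀ᵗ g` by `tᵐ` decreases. -/
theorem integral_mul_le_pow_mul (hmono : MonotoneOn g (Ici 0)) (hcont : ContinuousOn g (Ioi 0))
    {m : ℕ} (hm : ∀ t, 0 < t → g t * t ≤ m * ∫ τ in (0 : ℝ)..t, g τ)
    {c t : ℝ} (hc : 1 ≤ c) (ht : 0 ≤ t) :
    ∫ τ in (0 : ℝ)..(c * t), g τ ≤ c ^ m * ∫ τ in (0 : ℝ)..t, g τ := by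
  rcases ht.eq_or_lt with rfl | ht
  · simp
  have hd : ∀ r : ℝ, 0 < r → HasDerivAt (fun r => (∫ τ in (0 : ℝ)..r, g τ) / r ^ m)
      ((g r * r ^ m - (∫ τ in (0 : ℝ)..r, g τ) * (m * r ^ (m - 1))) / (r ^ m) ^ 2) r :=
    fun r hr => (hasDerivAt_integral_of_monotoneOn hmono hcont hr).div (hasDerivAt_pow m r)
      (pow_pos hr m).ne'
  have hanti : AntitoneOn (fun r => (∫ τ in (0 : ℝ)..r, g τ) / r ^ m) (Ioi 0) := by
    refine antitoneOn_of_deriv_nonpos (convex_Ioi 0)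
      (fun r hr => (hd r hr).continuousAt.continuousWithinAt) ?_ ?_
    · rw [interior_Ioi]
      exact fun r hr => (hd r hr).differentiableAt.differentiableWithinAt
    · rw [interior_Ioi]
      intro r hr
      have hr : 0 < r := hr
      rw [(hd r hr).deriv]
      refine div_nonpos_of_nonpos_of_nonneg ?_ (by positivity)
      have h1 := hm r hr
      -- The exponent `m - 1` is truncated subtraction, so `m = 0` is treated apart.
      rcases m with _ | m
      · simp only [pow_zero, mul_one, Nat.cast_zero, zero_mul, mul_zero, sub_zero] at h1 ⊢
        exact nonpos_of_mul_nonpos_left h1 hr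
      · rw [Nat.add_sub_cancel, pow_succ]
        have := mul_le_mul_of_nonneg_right h1 (pow_pos hr m).le
        linarith
  have hct : 0 < c * t := by positivity
  have h := hanti (mem_Ioi.2 ht) (mem_Ioi.2 hct) (le_mul_of_one_le_left ht.le hc)
  simp only at h
  rw [div_le_div_iff₀ (by positivity) (by positivity), mul_pow] at h
  have htm : 0 < t ^ m := by positivity
  nlinarith

end Young

end MusielakSobolev

/-! ### Young families and modular densities -/

namespace MusielakSobolev

variable {n : ℕ}

/-- A family `K z` of Young functions with a uniform polynomial growth bound. -/
structure IsYoungFamily (K : E n → ℝ → ℝ) (m : ℕ) (C : ℝ) : Prop where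
  zero : ∀ z, K z 0 = 0
  nonneg : ∀ z t, 0 ≤ t → 0 ≤ K z t
  continuousOn : ∀ z, ContinuousOn (K z) (Ici 0)
  monotoneOn : ∀ z, MonotoneOn (K z) (Ici 0)
  convexOn : ∀ z, ConvexOn ℝ (Ici 0) (K z)
  growth : ∀ z c t, 1 ≤ c → 0 ≤ t → K z (c * t) ≤ c ^ m * K z t
  le_bound : ∀ z, K z 1 ≤ C
  pos : ∀ z t, 0 < t → 0 < K z t
  aemeasurable : ∀ t, 0 ≤ t → AEMeasurable (fun z => K z t)

variable {a : E n → E n → ℝ → ℝ}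

theorem gFun_monotoneOn (ha : Nonneg a) (hg3 : CondG3 a) (x y : E n) :
    MonotoneOn (gFun a x y) (Ici 0) := by
  intro t ht t' ht' htt'
  have ht : (0 : ℝ) ≤ t := ht
  rcases ht.eq_or_lt with rfl | ht
  · rcases htt'.eq_or_lt with rfl | h'
    · exact le_rfl
    · simp only [gFun, if_true, h'.ne', if_false]
      exact mul_nonneg (ha x y t' h') h'.le
  · have h' : 0 < t' := ht.trans_le htt'
    simp only [gFun, ht.ne', h'.ne', if_false]
    exact hg3 x y ht h' htt'

theorem gFun_continuousOn (hg2 : CondG2 a) (x y : E n) :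
    ContinuousOn (gFun a x y) (Ioi 0) := by
  refine ((hg2 x y).mul continuousOn_id).congr fun t ht => ?_
  have ht : (0 : ℝ) < t := ht
  simp [gFun, ht.ne']

theorem G_eq_G_sub (hH2 : CondH2 a) (x y : E n) {t : ℝ} (ht : 0 ≤ t) :
    G a x y t = G a (x - y) 0 t := by
  have := hH2 x y y t ht
  rw [sub_self] at this
  exact this.symm

/-- A measure-preserving shear turns $G_{x,y}$ into a function of $x-y$ alone. By Fubini almost
every slice is measurable, and all slices are the same function. -/
theorem aemeasurable_G_zero (hG : Caratheodory a) (hH2 : CondH2 a) {t : ℝ} (ht : 0 ≤ t) :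
    AEMeasurable (fun z => G a z 0 t) := by
  have h1 := hG.1 t ht
  have hmp : MeasurePreserving (fun p : E n × E n => (p.2 + p.1, p.1))
      (volume.prod volume) (volume.prod volume) := by
    convert Measure.measurePreserving_swap.comp
      (measurePreserving_prod_add (volume : Measure (E n)) (volume : Measure (E n))) using 1
    ext p : 1
    simp [add_comm]
  have h2 : AEMeasurable (fun p : E n × E n => G a p.2 0 t) (volume.prod volume) := by
    refine (h1.comp_quasiMeasurePreserving hmp.quasiMeasurePreserving).congr ?_
    refine ae_of_all _ fun p => ?_
    simp only [Function.comp]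
    rw [G_eq_G_sub hH2 _ _ ht]
    simp
  have h3 := h2.aestronglyMeasurable.prodMk_left
  obtain ⟨x, hx⟩ := h3.exists
  exact hx.aemeasurable

theorem exists_isYoungFamily (ha : Nonneg a) (hG : Caratheodory a) (hg2 : CondG2 a)
    (hg3 : CondG3 a) (hg4 : CondG4 a) (hH2 : CondH2 a) (hBf : CondBf a) :
    ∃ m C, IsYoungFamily (fun z => G a z 0) m C := by
  obtain ⟨gm, gp, hgm, hg⟩ := hg4
  obtain ⟨C₁, C₂, -, -, hC⟩ := hBf
  obtain ⟨m, hm⟩ := exists_nat_ge gp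
  have hmono := gFun_monotoneOn ha hg3
  have hcont := gFun_continuousOn hg2
  have h0 : ∀ x y, gFun a x y 0 = 0 := fun x y => by simp [gFun]
  have hpos : ∀ x y t, 0 < t → 0 < G a x y t := by
    intro x y t ht
    -- If $G$ vanished at $t$, the quotient in $(g_4)$ would be `0` by convention, contradicting
    -- $g^->1$.
    refine (integral_nonneg_of_monotoneOn (hmono x y) (h0 x y) ht.le).lt_of_ne fun h => ?_
    have h1 := (hg x y t ht).1
    have h2 : G a x y t = 0 := h.symm
    rw [h2, div_zero] at h1
    linarith
  refine ⟨m, C₂, ⟨fun z => by simp [G], fun z t ht => ?_, fun z => ?_, fun z => ?_, fun z => ?_,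
    fun z c t hc ht => ?_, fun z => (hC z 0).2, fun z => hpos z 0,
    fun t ht => aemeasurable_G_zero hG hH2 ht⟩⟩
  · exact integral_nonneg_of_monotoneOn (hmono z 0) (h0 z 0) ht
  · exact continuousOn_integral_of_monotoneOn (hmono z 0)
  · exact integral_mono_of_monotoneOn (hmono z 0) (h0 z 0)
  · exact convexOn_integral_of_monotoneOn (hmono z 0) (hcont z 0)
  · refine integral_mul_le_pow_mul (hmono z 0) (hcont z 0) (fun t ht => ?_) hc ht
    have h1 := (hg z 0 t ht).2
    have h2 := hpos z 0 t ht
    rw [div_le_iff₀ h2] at h1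
    have h3 : gFun a z 0 t * t = a z 0 t * t ^ 2 := by
      simp only [gFun, ht.ne', if_false]; ring
    rw [h3]
    exact h1.trans (mul_le_mul_of_nonneg_right hm h2.le)

/-! ### Modular densities -/

/-- A convex even density with polynomial growth, with values in `[0, ∞]`. -/
structure IsModularDensity (m : ℕ) (ρ : ℝ → ℝ≥0∞) : Prop where
  continuous : Continuous ρ
  mono : ∀ t t', |t| ≤ |t'| → ρ t ≤ ρ t'
  zero : ρ 0 = 0
  scale : ∀ c t, 1 ≤ c → ρ (c * t) ≤ ENNReal.ofReal (c ^ m) * ρ t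
  le_linear : ∀ T, ∃ B : ℝ≥0, ∀ t, |t| ≤ T → ρ t ≤ B * ‖t‖ₑ
  jensen : ∀ (μ : Measure (E n)) [IsProbabilityMeasure μ] (f : E n → ℝ) (T : ℝ),
    Measurable f → (∀ x, |f x| ≤ T) → ρ (∫ x, f x ∂μ) ≤ ∫⁻ x, ρ (f x) ∂μ

/-- Convexity and $K_z(0)=0$ put $K_z$ below its chord on $[0,\max(1,T)]$. Growth from $t=1$ and the
common bound there make the slope uniform in $z$. -/
theorem IsYoungFamily.le_linear {K : E n → ℝ → ℝ} {m : ℕ} {C : ℝ} (hK : IsYoungFamily K m C)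
    (T : ℝ) : ∃ B : ℝ, 0 ≤ B ∧ ∀ z t, 0 ≤ t → t ≤ T → K z t ≤ B * t := by
  have hC : 0 ≤ C := (hK.nonneg 0 1 zero_le_one).trans (hK.le_bound 0)
  refine ⟨C * (max 1 T) ^ m, by positivity, fun z t ht htT => ?_⟩
  have hT1 : (1 : ℝ) ≤ max 1 T := le_max_left _ _
  have hcv : K z t ≤ t / max 1 T * K z (max 1 T) := by
    have hq : t / max 1 T ≤ 1 := by
      rw [div_le_one (by positivity)]; exact htT.trans (le_max_right _ _)
    have := (hK.convexOn z).2 (mem_Ici.2 le_rfl) (mem_Ici.2 (zero_le_one.trans hT1))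
      (sub_nonneg.2 hq) (div_nonneg ht (by positivity))
      (show (1 - t / max 1 T) + t / max 1 T = 1 by ring)
    simp only [smul_eq_mul, mul_zero, zero_add, hK.zero] at this
    rwa [div_mul_cancel₀ _ (by positivity)] at this
  have h2 := hK.growth z (max 1 T) 1 hT1 zero_le_one
  rw [mul_one] at h2
  have h3 : K z (max 1 T) ≤ C * max 1 T ^ m := by
    refine h2.trans ?_
    rw [mul_comm]
    exact mul_le_mul_of_nonneg_right (hK.le_bound z) (by positivity)
  calc K z t ≤ t / max 1 T * (C * max 1 T ^ m) :=
        hcv.trans (mul_le_mul_of_nonneg_left h3 (by positivity))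
    _ ≤ t * (C * max 1 T ^ m) :=
        mul_le_mul_of_nonneg_right (div_le_self ht hT1) (by positivity)
    _ = _ := by ring

/-- The parameters may vanish: division by zero then makes the density identically zero, so the
kernel at $z=0$ needs no exception. -/
theorem IsYoungFamily.isModularDensity {K : E n → ℝ → ℝ} {m : ℕ} {C : ℝ}
    (hK : IsYoungFamily K m C) (z : E n) {α β : ℝ} (hα : 0 ≤ α) (hβ : 0 ≤ β) :
    IsModularDensity (n := n) m (fun t => ENNReal.ofReal (K z (|t| / α) / β)) := by
  have harg : ∀ t : ℝ, 0 ≤ |t| / α := fun t => by positivity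
  have hc : Continuous fun t => K z (|t| / α) / β :=
    ((hK.continuousOn z).comp_continuous (by fun_prop) (fun t => harg t)).div_const _
  have hconv : ConvexOn ℝ univ fun t => K z (|t| / α) / β := by
    have h1 : ConvexOn ℝ univ fun t : ℝ => |t| / α := by
      have : ConvexOn ℝ univ fun t : ℝ => α⁻¹ • ‖t‖ :=
        (convexOn_norm convex_univ).smul (inv_nonneg.2 hα)
      refine this.congr fun t _ => ?_
      simp [div_eq_inv_mul]
    refine ⟨convex_univ, fun t _ t' _ p q hp hq hpq => ?_⟩
    have h2 := h1.2 (mem_univ t) (mem_univ t') hp hq hpq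
    have h3 := hK.monotoneOn z (mem_Ici.2 (harg _))
      (mem_Ici.2 ((harg _).trans h2)) h2
    have h4 := (hK.convexOn z).2 (mem_Ici.2 (harg t)) (mem_Ici.2 (harg t')) hp hq hpq
    simp only [smul_eq_mul] at h3 h4 ⊢
    rw [mul_div_assoc', mul_div_assoc', ← add_div]
    exact div_le_div_of_nonneg_right (h3.trans h4) hβ
  have hmono : ∀ t t' : ℝ, |t| ≤ |t'| → K z (|t| / α) / β ≤ K z (|t'| / α) / β := fun t t' h =>
    div_le_div_of_nonneg_right (hK.monotoneOn z (mem_Ici.2 (harg t)) (mem_Ici.2 (harg t'))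
      (div_le_div_of_nonneg_right h hα)) hβ
  have hnn : ∀ t, 0 ≤ K z (|t| / α) / β := fun t => div_nonneg (hK.nonneg z _ (harg t)) hβ
  refine ⟨ENNReal.continuous_ofReal.comp hc, fun t t' h => ENNReal.ofReal_le_ofReal (hmono t t' h),
    by simp [hK.zero], fun c t hc1 => ?_, fun T => ?_, fun μ _ f T hf hfT => ?_⟩
  · rw [← ENNReal.ofReal_mul (by positivity)]
    refine ENNReal.ofReal_le_ofReal ?_
    rw [abs_mul, abs_of_nonneg (zero_le_one.trans hc1), mul_div_assoc, ← mul_div_assoc (c ^ m)]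
    exact div_le_div_of_nonneg_right (hK.growth z c _ hc1 (harg t)) hβ
  · obtain ⟨B, hB, hBt⟩ := hK.le_linear (T / α)
    refine ⟨Real.toNNReal (B / α / β), fun t ht => ?_⟩
    rw [Real.enorm_eq_ofReal_abs, ← ENNReal.ofReal, ← ENNReal.ofReal_mul (by positivity)]
    refine ENNReal.ofReal_le_ofReal ?_
    have := hBt z (|t| / α) (harg t) (div_le_div_of_nonneg_right ht hα)
    calc K z (|t| / α) / β ≤ B * (|t| / α) / β := div_le_div_of_nonneg_right this hβ
      _ = B / α / β * |t| := by ring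
  · have hint : Integrable f μ := Integrable.of_bound hf.aestronglyMeasurable T
      (ae_of_all _ fun x => hfT x)
    have hint2 : Integrable ((fun t => K z (|t| / α) / β) ∘ f) μ := by
      refine Integrable.of_bound (hc.measurable.comp hf).aestronglyMeasurable
        (K z (|T| / α) / β) (ae_of_all _ fun x => ?_)
      rw [Function.comp, Real.norm_of_nonneg (hnn _)]
      exact hmono _ _ ((hfT x).trans (le_abs_self T))
    have h := hconv.map_integral_le hc.continuousOn isClosed_univ
      (ae_of_all _ fun x => mem_univ (f x)) hint hint2
    refine (ENNReal.ofReal_le_ofReal h).trans ?_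
    exact (ofReal_integral_eq_lintegral_ofReal hint2 (ae_of_all _ fun x => hnn (f x))).le

/-- Carathéodory functions of a measurable function are measurable. -/
theorem IsYoungFamily.aemeasurable_comp {K : E n → ℝ → ℝ} {m : ℕ} {C : ℝ}
    (hK : IsYoungFamily K m C) {f : E n × E n → ℝ} (hf : Measurable f) (hf0 : ∀ p, 0 ≤ f p) :
    AEMeasurable (fun p : E n × E n => K p.1 (f p)) (volume.prod volume) := by
  -- Round `f` down to a multiple of $1/(k+1)$. On each of the countably many level sets the second
  -- argument is constant, and continuity in $t$ passes to the limit.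
  have happ : ∀ k : ℕ, AEMeasurable
      (fun p : E n × E n => K p.1 ((⌊f p * (k + 1)⌋₊ : ℝ) / (k + 1))) (volume.prod volume) := by
    intro k
    have hq : ∀ q : ℕ, AEMeasurable (fun p : E n × E n => K p.1 ((q : ℝ) / (k + 1)))
        (volume.prod volume) := fun q =>
      (hK.aemeasurable ((q : ℝ) / (k + 1)) (by positivity)).comp_quasiMeasurePreserving
        Measure.quasiMeasurePreserving_fst
    have hfl : Measurable fun p => ⌊f p * (k + 1)⌋₊ :=
      Nat.measurable_floor.comp (hf.mul_const _)
    have hcover : (⋃ q : ℕ, {p | ⌊f p * (k + 1)⌋₊ = q}) = univ := by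
      ext p; simp
    rw [← Measure.restrict_univ (μ := (volume : Measure (E n)).prod (volume : Measure (E n))),
      ← hcover, aemeasurable_iUnion_iff]
    intro q
    refine ((hq q).restrict).congr ?_
    filter_upwards [ae_restrict_mem (hfl (measurableSet_singleton q))] with p hp
    have hp : ⌊f p * (k + 1)⌋₊ = q := hp
    rw [hp]
  refine aemeasurable_of_tendsto_metrizable_ae' happ (ae_of_all _ fun p => ?_)
  have h1 : Tendsto (fun k : ℕ => (⌊f p * (k + 1)⌋₊ : ℝ) / (k + 1)) atTop (𝓝 (f p)) := by
    have h2 := (tendsto_nat_floor_mul_div_atTop (R := ℝ) (hf0 p)).comp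
      (tendsto_atTop_add_const_right atTop (1 : ℝ) tendsto_natCast_atTop_atTop)
    exact h2
  refine ((hK.continuousOn p.1) (f p) (mem_Ici.2 (hf0 p))).tendsto.comp
    (tendsto_nhdsWithin_iff.2 ⟨h1, Eventually.of_forall fun k => mem_Ici.2 (by positivity)⟩)

end MusielakSobolev

/-! ### The Gagliardo kernel and its integrable weight -/

namespace MusielakSobolev

variable {n : ℕ}

/-- The weight `min(1, |z|) / |z|^(s + N)`, integrable on `ℝ^N`. -/
noncomputable def cutoffWeight (n : ℕ) (s : ℝ) (z : E n) : ℝ≥0∞ :=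
  ENNReal.ofReal (min 1 ‖z‖ / ‖z‖ ^ s / ‖z‖ ^ (n + 1))

theorem measurable_cutoffWeight (s : ℝ) : Measurable (cutoffWeight n s) := by
  unfold cutoffWeight
  fun_prop

/-- In polar coordinates the integrand is $r^{-s}$ on $(0,1]$, integrable since $s<1$, and
$r^{-s-1}$ on $(1,\infty)$, integrable since $s>0$. -/
theorem lintegral_cutoffWeight_ne_top {s : ℝ} (hs : s ∈ Ioo (0 : ℝ) 1) :
    ∫⁻ z, cutoffWeight n s z ≠ ⊤ := by
  have hint : Integrable (fun z : E n => (fun r : ℝ => min 1 r / r ^ s / r ^ (n + 1)) ‖z‖) := by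
    rw [integrable_fun_norm_addHaar (volume : Measure (E n))
      (f := fun r : ℝ => min 1 r / r ^ s / r ^ (n + 1)), ← Ioc_union_Ioi_eq_Ioi zero_le_one]
    have hdim : Module.finrank ℝ (E n) - 1 = n := by simp
    rw [hdim]
    refine IntegrableOn.union ?_ ?_
    · have h : IntegrableOn (fun r : ℝ => r ^ (-s)) (Ioc 0 1) :=
        (intervalIntegrable_iff_integrableOn_Ioc_of_le zero_le_one).1
          (intervalIntegral.intervalIntegrable_rpow' (by linarith [hs.2]))
      refine h.congr_fun (fun r hr => ?_) measurableSet_Ioc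
      have hr0 : (0 : ℝ) < r := hr.1
      simp only [smul_eq_mul, min_eq_right hr.2, Real.rpow_neg hr0.le]
      field_simp
      ring
    · have h : IntegrableOn (fun r : ℝ => r ^ (-s - 1)) (Ioi 1) :=
        integrableOn_Ioi_rpow_of_lt (by linarith [hs.1]) zero_lt_one
      refine h.congr_fun (fun r hr => ?_) measurableSet_Ioi
      have hr1 : (1 : ℝ) < r := hr
      have hr0 : (0 : ℝ) < r := zero_lt_one.trans hr
      simp only [smul_eq_mul, min_eq_left hr1.le, Real.rpow_sub hr0, Real.rpow_neg hr0.le,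
        Real.rpow_one]
      field_simp
      ring
  exact (hasFiniteIntegral_iff_ofReal (ae_of_all _ fun z => by positivity)).1
    hint.hasFiniteIntegral |>.ne

/-- The properties of `P z t = G_z(|t| / |z|^s) / |z|^N` used for the density of smooth
functions; `w` is a weight dominating `P` on Lipschitz increments. -/
structure IsGagliardoKernel (m : ℕ) (P : E n → ℝ → ℝ≥0∞) (w : E n → ℝ≥0∞) : Prop where
  density : ∀ z, IsModularDensity (n := n) m (P z)
  aemeasurable : ∀ f : E n × E n → ℝ, Measurable f →
    AEMeasurable (fun p : E n × E n => P p.1 (f p)) (volume.prod volume)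
  le_weight : ∀ T, ∃ A : ℝ≥0, ∀ z t b, |b| ≤ T → |t| ≤ |b| * min 1 ‖z‖ → P z t ≤ A * ‖b‖ₑ * w z
  measurable_weight : Measurable w
  lintegral_weight : ∫⁻ z, w z ≠ ⊤

/-- The integrand of the fractional modular in the variable `z = x - y`. -/
noncomputable def gagliardoKernel (K : E n → ℝ → ℝ) (s : ℝ) (z : E n) (t : ℝ) : ℝ≥0∞ :=
  ENNReal.ofReal (K z (|t| / ‖z‖ ^ s) / ‖z‖ ^ (n + 1))

theorem IsYoungFamily.isGagliardoKernel {K : E n → ℝ → ℝ} {m : ℕ} {C : ℝ}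
    (hK : IsYoungFamily K m C) {s : ℝ} (hs : s ∈ Ioo (0 : ℝ) 1) :
    IsGagliardoKernel m (gagliardoKernel K s) (cutoffWeight n s) where
  density z := hK.isModularDensity z (by positivity) (by positivity)
  aemeasurable f hf := by
    have h := hK.aemeasurable_comp (f := fun p => |f p| / ‖p.1‖ ^ s)
      (by fun_prop) (fun p => by positivity)
    have h2 : Measurable fun p : E n × E n => ‖p.1‖ ^ (n + 1) := by fun_prop
    exact (h.div h2.aemeasurable).ennreal_ofReal
  le_weight T := by
    obtain ⟨B, hB, hBt⟩ := hK.le_linear T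
    refine ⟨B.toNNReal, fun z t b hb ht => ?_⟩
    rw [gagliardoKernel, cutoffWeight, Real.enorm_eq_ofReal_abs, ← ENNReal.ofReal,
      ← ENNReal.ofReal_mul hB, ← ENNReal.ofReal_mul (by positivity)]
    refine ENNReal.ofReal_le_ofReal ?_
    rcases eq_or_ne z 0 with rfl | hz
    · simp
    have hz : 0 < ‖z‖ := norm_pos_iff.2 hz
    -- This keeps the argument of $K_z$ below $T$, where the linear bound holds. The factor
    -- $\min(1,|z|)$ that survives in that bound is the numerator of the weight.
    have hθ : min 1 ‖z‖ ≤ ‖z‖ ^ s := by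
      rcases le_total 1 ‖z‖ with h | h
      · exact (min_le_left _ _).trans (Real.one_le_rpow h hs.1.le)
      · refine (min_le_right _ _).trans ?_
        simpa using Real.rpow_le_rpow_of_exponent_ge hz h hs.2.le
    have hzs : 0 < ‖z‖ ^ s := Real.rpow_pos_of_pos hz s
    have h1 : |t| / ‖z‖ ^ s ≤ T := by
      rw [div_le_iff₀ hzs]
      exact ht.trans (mul_le_mul hb hθ (by positivity) ((abs_nonneg b).trans hb))
    have h2 := hBt z _ (by positivity) h1
    calc K z (|t| / ‖z‖ ^ s) / ‖z‖ ^ (n + 1)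
        ≤ B * (|b| * min 1 ‖z‖ / ‖z‖ ^ s) / ‖z‖ ^ (n + 1) := by
          refine div_le_div_of_nonneg_right (h2.trans ?_) (by positivity)
          exact mul_le_mul_of_nonneg_left (div_le_div_of_nonneg_right ht hzs.le) hB
      _ = _ := by ring
  measurable_weight := measurable_cutoffWeight s
  lintegral_weight := lintegral_cutoffWeight_ne_top hs

theorem IsModularDensity.add_le {m : ℕ} {ρ : ℝ → ℝ≥0∞} (hρ : IsModularDensity (n := n) m ρ)
    (t t' : ℝ) : ρ (t + t') ≤ ENNReal.ofReal (2 ^ m) * (ρ t + ρ t') := by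
  rcases le_total |t| |t'| with h | h
  · calc ρ (t + t') ≤ ρ (2 * t') := hρ.mono _ _ (by
          rw [abs_mul, abs_two]; linarith [abs_add_le t t'])
      _ ≤ _ := (hρ.scale 2 t' one_le_two).trans (by gcongr; exact le_add_self)
  · calc ρ (t + t') ≤ ρ (2 * t) := hρ.mono _ _ (by
          rw [abs_mul, abs_two]; linarith [abs_add_le t t'])
      _ ≤ _ := (hρ.scale 2 t one_le_two).trans (by gcongr; exact le_self_add)

theorem IsModularDensity.congr_abs {m : ℕ} {ρ : ℝ → ℝ≥0∞} (hρ : IsModularDensity (n := n) m ρ)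
    {t t' : ℝ} (h : |t| = |t'|) : ρ t = ρ t' :=
  le_antisymm (hρ.mono _ _ h.le) (hρ.mono _ _ h.ge)

end MusielakSobolev

/-! ### Energy and limits of smooth functions -/

namespace MusielakSobolev

variable {n : ℕ}

/-- The modular of the increments of `v` in the direction `z`. -/
noncomputable def incrementModular (P : E n → ℝ → ℝ≥0∞) (v : E n → ℝ) (z : E n) : ℝ≥0∞ :=
  ∫⁻ y, P z (v (y + z) - v y)

/-- The sum of the modular of `v` and of the fractional modular of `v`. -/
noncomputable def energy (Q : ℝ → ℝ≥0∞) (P : E n → ℝ → ℝ≥0∞) (v : E n → ℝ) : ℝ≥0∞ :=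
  (∫⁻ x, Q (v x)) + ∫⁻ z, incrementModular P v z

variable {m : ℕ} {Q : ℝ → ℝ≥0∞} {P : E n → ℝ → ℝ≥0∞} {w : E n → ℝ≥0∞} {u v : E n → ℝ}

theorem IsModularDensity.measurable_increment {ρ : ℝ → ℝ≥0∞}
    (hρ : IsModularDensity (n := n) m ρ) (hv : Measurable v) (z : E n) :
    Measurable fun y => ρ (v (y + z) - v y) :=
  hρ.continuous.measurable.comp ((hv.comp (measurable_add_const z)).sub hv)

theorem IsGagliardoKernel.aemeasurable_prod (hP : IsGagliardoKernel m P w) (hv : Measurable v) :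
    AEMeasurable (fun p : E n × E n => P p.1 (v (p.2 + p.1) - v p.2))
      (volume.prod volume) :=
  hP.aemeasurable (fun p => v (p.2 + p.1) - v p.2)
    ((hv.comp (measurable_snd.add measurable_fst)).sub (hv.comp measurable_snd))

theorem IsGagliardoKernel.aemeasurable_incrementModular (hP : IsGagliardoKernel m P w)
    (hv : Measurable v) : AEMeasurable (incrementModular P v) :=
  (hP.aemeasurable_prod hv).lintegral_prod_right'

theorem IsGagliardoKernel.incrementModular_add_le (hP : IsGagliardoKernel m P w)
    (hu : Measurable u) (z : E n) :
    incrementModular P (u + v) z ≤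
      ENNReal.ofReal (2 ^ m) * (incrementModular P u z + incrementModular P v z) := by
  unfold incrementModular
  rw [← lintegral_add_left ((hP.density z).measurable_increment hu z),
    ← lintegral_const_mul' _ _ ENNReal.ofReal_ne_top]
  refine lintegral_mono fun y => ?_
  have := (hP.density z).add_le (u (y + z) - u y) (v (y + z) - v y)
  convert this using 2
  simp only [Pi.add_apply]
  ring

theorem IsGagliardoKernel.incrementModular_neg (hP : IsGagliardoKernel m P w) (z : E n) :
    incrementModular P (-v) z = incrementModular P v z := by
  unfold incrementModular
  refine lintegral_congr fun y => (hP.density z).congr_abs ?_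
  rw [← abs_neg]
  simp only [Pi.neg_apply]
  congr 1
  ring

theorem energy_add_le (hQ : IsModularDensity (n := n) m Q) (hP : IsGagliardoKernel m P w)
    (hu : Measurable u) :
    energy Q P (u + v) ≤ ENNReal.ofReal (2 ^ m) * (energy Q P u + energy Q P v) := by
  have h1 : ∫⁻ x, Q ((u + v) x) ≤
      ENNReal.ofReal (2 ^ m) * ((∫⁻ x, Q (u x)) + ∫⁻ x, Q (v x)) := by
    have hm : Measurable fun x => Q (u x) := hQ.continuous.measurable.comp hu
    rw [← lintegral_add_left hm,
      ← lintegral_const_mul' _ _ ENNReal.ofReal_ne_top]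
    exact lintegral_mono fun x => hQ.add_le (u x) (v x)
  have h2 : ∫⁻ z, incrementModular P (u + v) z ≤ ENNReal.ofReal (2 ^ m) *
      ((∫⁻ z, incrementModular P u z) + ∫⁻ z, incrementModular P v z) := by
    rw [← lintegral_add_left' (hP.aemeasurable_incrementModular hu),
      ← lintegral_const_mul' _ _ ENNReal.ofReal_ne_top]
    exact lintegral_mono fun z => hP.incrementModular_add_le hu z
  calc energy Q P (u + v) ≤ _ := add_le_add h1 h2
    _ = _ := by unfold energy; ring

/-- `u` is a limit of functions of `C_0^∞(Ω)` with respect to the energy. -/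
def IsSmoothLimit (Q : ℝ → ℝ≥0∞) (P : E n → ℝ → ℝ≥0∞) (Ω : Set (E n)) (u : E n → ℝ) : Prop :=
  ∀ δ : ℝ≥0∞, δ ≠ 0 → ∃ φ ∈ CcInfty Ω, energy Q P (u - φ) ≤ δ

theorem exists_mul_add_le {c δ : ℝ≥0∞} (hc : c ≠ ⊤) (hδ : δ ≠ 0) :
    ∃ δ' : ℝ≥0∞, δ' ≠ 0 ∧ c * (δ' + δ') ≤ δ := by
  refine ⟨δ / (c * 2), ENNReal.div_ne_zero.2 ⟨hδ, ENNReal.mul_ne_top hc (by simp)⟩, ?_⟩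
  rw [← two_mul, ← mul_assoc]
  exact ENNReal.mul_div_le

theorem measurable_of_mem_CcInfty {Ω : Set (E n)} {φ : E n → ℝ} (hφ : φ ∈ CcInfty Ω) :
    Measurable φ := hφ.1.continuous.measurable

theorem IsSmoothLimit.of_approx {Ω : Set (E n)} (hQ : IsModularDensity (n := n) m Q)
    (hP : IsGagliardoKernel m P w) (hu : Measurable u)
    (h : ∀ δ : ℝ≥0∞, δ ≠ 0 → ∃ v, Measurable v ∧ IsSmoothLimit Q P Ω v ∧ energy Q P (u - v) ≤ δ) :
    IsSmoothLimit Q P Ω u := by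
  intro δ hδ
  obtain ⟨δ', hδ', hle⟩ := exists_mul_add_le (c := ENNReal.ofReal (2 ^ m))
    ENNReal.ofReal_ne_top hδ
  obtain ⟨v, hv, hlim, hv'⟩ := h δ' hδ'
  obtain ⟨φ, hφ, hφ'⟩ := hlim δ' hδ'
  refine ⟨φ, hφ, ?_⟩
  rw [← sub_add_sub_cancel u v φ]
  refine (energy_add_le hQ hP (hu.sub hv)).trans (le_trans ?_ hle)
  gcongr

theorem IsSmoothLimit.of_tendsto {Ω : Set (E n)} (hQ : IsModularDensity (n := n) m Q)
    (hP : IsGagliardoKernel m P w) (hu : Measurable u) {U : ℕ → E n → ℝ}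
    (hU : ∀ k, Measurable (U k)) (hlim : ∀ k, IsSmoothLimit Q P Ω (U k))
    (h : Tendsto (fun k => energy Q P (u - U k)) atTop (𝓝 0)) : IsSmoothLimit Q P Ω u := by
  refine .of_approx hQ hP hu fun δ hδ => ?_
  obtain ⟨k, hk⟩ := (h.eventually (Iic_mem_nhds (pos_iff_ne_zero.2 hδ))).exists
  exact ⟨U k, hU k, hlim k, hk⟩

theorem IsSmoothLimit.add {Ω : Set (E n)} (hQ : IsModularDensity (n := n) m Q)
    (hP : IsGagliardoKernel m P w) (hu : Measurable u)
    (h1 : IsSmoothLimit Q P Ω u) (h2 : IsSmoothLimit Q P Ω v) :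
    IsSmoothLimit Q P Ω (u + v) := by
  intro δ hδ
  obtain ⟨δ', hδ', hle⟩ := exists_mul_add_le (c := ENNReal.ofReal (2 ^ m))
    ENNReal.ofReal_ne_top hδ
  obtain ⟨φ, hφ, hφ'⟩ := h1 δ' hδ'
  obtain ⟨ψ, hψ, hψ'⟩ := h2 δ' hδ'
  refine ⟨φ + ψ, ⟨hφ.1.add hψ.1, hφ.2.1.add hψ.2.1,
    (tsupport_add φ ψ).trans (union_subset hφ.2.2 hψ.2.2)⟩, ?_⟩
  rw [add_sub_add_comm]
  refine (energy_add_le hQ hP (hu.sub (measurable_of_mem_CcInfty hφ))).trans (le_trans ?_ hle)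
  gcongr

/-! ### Bounded integrable functions of finite fractional energy -/

/-- Bounded integrable functions of finite fractional energy. -/
structure IsAdmissible (P : E n → ℝ → ℝ≥0∞) (u : E n → ℝ) : Prop where
  measurable : Measurable u
  bounded : ∃ T, ∀ x, |u x| ≤ T
  integrable : Integrable u
  lintegral_ne_top : ∫⁻ z, incrementModular P u z ≠ ⊤

/-- If `U k → u` in `L¹`, boundedly, and the increments are dominated, then the energy
of the difference tends to zero. -/
theorem tendsto_energy_of_dominated (hQ : IsModularDensity (n := n) m Q)
    (hP : IsGagliardoKernel m P w) {U : ℕ → E n → ℝ} (hu : Measurable u)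
    (hU : ∀ k, Measurable (U k)) {T : ℝ} (huT : ∀ x, |u x| ≤ T) (hUT : ∀ k x, |U k x| ≤ T)
    (hL1 : Tendsto (fun k => ∫⁻ x, ‖u x - U k x‖ₑ) atTop (𝓝 0))
    {H : E n → ℝ≥0∞} (hH : ∫⁻ z, H z ≠ ⊤) (huH : ∀ z, incrementModular P u z ≤ H z)
    (hUH : ∀ k z, incrementModular P (U k) z ≤ H z) :
    Tendsto (fun k => energy Q P (u - U k)) atTop (𝓝 0) := by
  have hbd : ∀ k x, |u x - U k x| ≤ T + T := fun k x =>
    (abs_sub _ _).trans (add_le_add (huT x) (hUT k x))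
  have h1 : Tendsto (fun k => ∫⁻ x, Q ((u - U k) x)) atTop (𝓝 0) := by
    obtain ⟨B, hB⟩ := hQ.le_linear (T + T)
    have h := ENNReal.Tendsto.const_mul (a := (B : ℝ≥0∞)) hL1 (Or.inr ENNReal.coe_ne_top)
    rw [mul_zero] at h
    refine tendsto_of_tendsto_of_tendsto_of_le_of_le tendsto_const_nhds h
      (fun _ => zero_le) fun k => ?_
    rw [← lintegral_const_mul' _ _ ENNReal.coe_ne_top]
    exact lintegral_mono fun x => hB _ (hbd k x)
  -- Dominated convergence is applied in $z$ only.
  have h2 : Tendsto (fun k => ∫⁻ z, incrementModular P (u - U k) z) atTop (𝓝 0) := by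
    have h := tendsto_lintegral_of_dominated_convergence' (μ := volume)
      (F := fun k => incrementModular P (u - U k)) (f := fun _ => 0)
      (fun z => ENNReal.ofReal (2 ^ m) * (H z + H z))
      (fun k => hP.aemeasurable_incrementModular (hu.sub (hU k)))
      (fun k => ae_of_all _ fun z => ?_) ?_ (ae_of_all _ fun z => ?_)
    · simpa using h
    · simp only [sub_eq_add_neg]
      refine (hP.incrementModular_add_le hu z).trans ?_
      rw [hP.incrementModular_neg]
      exact mul_le_mul_right (add_le_add (huH z) (hUH k z)) _
    · rw [lintegral_const_mul' _ _ ENNReal.ofReal_ne_top]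
      refine ENNReal.mul_ne_top ENNReal.ofReal_ne_top ?_
      simp_rw [← two_mul]
      rw [lintegral_const_mul' _ _ (by simp)]
      exact ENNReal.mul_ne_top (by simp) hH
    -- The constant `B` depends on $z$ and may blow up as $z\to0$; only convergence for each fixed
    -- $z$ is needed here.
    · obtain ⟨B, hB⟩ := (hP.density z).le_linear ((T + T) + (T + T))
      have h := ENNReal.Tendsto.const_mul (a := (B : ℝ≥0∞) * 2) hL1 (Or.inr
        (ENNReal.mul_ne_top ENNReal.coe_ne_top (by simp)))
      rw [mul_zero] at h
      refine tendsto_of_tendsto_of_tendsto_of_le_of_le tendsto_const_nhds h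
        (fun _ => zero_le) fun k => ?_
      have hm : Measurable fun x => ‖u x - U k x‖ₑ := (hu.sub (hU k)).enorm
      calc incrementModular P (u - U k) z
          ≤ ∫⁻ y, B * (‖u (y + z) - U k (y + z)‖ₑ + ‖u y - U k y‖ₑ) := by
            refine lintegral_mono fun y => (hB _ ?_).trans ?_
            · exact (abs_sub _ _).trans (add_le_add (hbd k _) (hbd k _))
            · exact mul_le_mul_right enorm_sub_le _
        _ = B * 2 * ∫⁻ x, ‖u x - U k x‖ₑ := by
            rw [lintegral_const_mul' _ _ ENNReal.coe_ne_top, lintegral_add_right _ hm,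
              lintegral_add_right_eq_self (fun x => ‖u x - U k x‖ₑ) z, mul_assoc, two_mul]
  have := h1.add h2
  rw [add_zero] at this
  exact this

/-- Increments of the products of `u` with uniformly Lipschitz cutoffs are dominated. -/
theorem IsAdmissible.exists_dominating_mul (hP : IsGagliardoKernel m P w)
    (hu : IsAdmissible P u) (L : ℝ≥0) :
    ∃ H : E n → ℝ≥0∞, ∫⁻ z, H z ≠ ⊤ ∧ ∀ ψ : E n → ℝ, LipschitzWith L ψ →
      (∀ x, ψ x ∈ Icc (0 : ℝ) 1) → ∀ z, incrementModular P (ψ * u) z ≤ H z := by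
  obtain ⟨T, hT⟩ := hu.bounded
  -- The `1` bounds the increments of $\psi$ for $|z|\ge1$, its values lying in $[0,1]$; `L` bounds
  -- them for $|z|\le1$.
  set L' : ℝ := max 1 L
  have hL' : 0 ≤ L' := zero_le_one.trans (le_max_left _ _)
  obtain ⟨A, hA⟩ := hP.le_weight (L' * T)
  have hI : ∫⁻ y, ‖L' * u y‖ₑ ≠ ⊤ := (hu.integrable.const_mul L').hasFiniteIntegral.ne
  refine ⟨fun z => ENNReal.ofReal (2 ^ m) *
    (incrementModular P u z + A * (∫⁻ y, ‖L' * u y‖ₑ) * w z), ?_, fun ψ hψ hψ1 z => ?_⟩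
  · rw [lintegral_const_mul' _ _ ENNReal.ofReal_ne_top,
      lintegral_add_left' (hP.aemeasurable_incrementModular hu.measurable),
      lintegral_const_mul _ hP.measurable_weight]
    exact ENNReal.mul_ne_top ENNReal.ofReal_ne_top (ENNReal.add_ne_top.2 ⟨hu.lintegral_ne_top,
      ENNReal.mul_ne_top (ENNReal.mul_ne_top ENNReal.coe_ne_top hI) hP.lintegral_weight⟩)
  · have hm := (hP.density z).measurable_increment hu.measurable z
    have hm2 : Measurable fun y => ‖L' * u y‖ₑ := (hu.measurable.const_mul L').enorm
    calc incrementModular P (ψ * u) z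
        ≤ ∫⁻ y, ENNReal.ofReal (2 ^ m) * (P z (u (y + z) - u y) + A * ‖L' * u y‖ₑ * w z) := by
          refine lintegral_mono fun y => ?_
          -- Discrete Leibniz rule: the first term is controlled by the increment of $u$, the second
          -- by the weight times $|u(y)|$.
          have hsplit : (ψ * u) (y + z) - (ψ * u) y
              = ψ (y + z) * (u (y + z) - u y) + (ψ (y + z) - ψ y) * u y := by
            simp only [Pi.mul_apply]; ring
          simp only
          rw [hsplit]
          refine ((hP.density z).add_le _ _).trans ?_
          gcongr
          · refine (hP.density z).mono _ _ ?_
            rw [abs_mul, abs_of_nonneg (hψ1 _).1]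
            exact mul_le_of_le_one_left (abs_nonneg _) (hψ1 _).2
          · refine hA _ _ _ ?_ ?_
            · rw [abs_mul, abs_of_nonneg hL']
              exact mul_le_mul_of_nonneg_left (hT y) hL'
            · have h1 : |ψ (y + z) - ψ y| ≤ L' * min 1 ‖z‖ := by
                rcases le_total 1 ‖z‖ with h | h
                · rw [min_eq_left h, mul_one]
                  refine le_trans ?_ (le_max_left _ _)
                  rw [abs_le]
                  constructor <;> linarith [(hψ1 y).1, (hψ1 y).2, (hψ1 (y + z)).1,
                    (hψ1 (y + z)).2]
                · rw [min_eq_right h]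
                  have := hψ.dist_le_mul (y + z) y
                  rw [Real.dist_eq, dist_self_add_left] at this
                  exact this.trans (mul_le_mul_of_nonneg_right (le_max_right _ _) (norm_nonneg _))
              rw [abs_mul, abs_mul, abs_of_nonneg hL']
              calc |ψ (y + z) - ψ y| * |u y| ≤ (L' * min 1 ‖z‖) * |u y| :=
                    mul_le_mul_of_nonneg_right h1 (abs_nonneg _)
                _ = _ := by ring
      _ = _ := by
          rw [lintegral_const_mul' _ _ ENNReal.ofReal_ne_top, lintegral_add_left hm,
            lintegral_mul_const _ (hm2.const_mul _), lintegral_const_mul _ hm2]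
          rfl

theorem IsAdmissible.mul (hP : IsGagliardoKernel m P w) (hu : IsAdmissible P u)
    {L : ℝ≥0} {ψ : E n → ℝ} (hψ : LipschitzWith L ψ) (hψ1 : ∀ x, ψ x ∈ Icc (0 : ℝ) 1) :
    IsAdmissible P (ψ * u) := by
  obtain ⟨H, hH, hle⟩ := hu.exists_dominating_mul hP L
  obtain ⟨T, hT⟩ := hu.bounded
  have hmul : ∀ x, |(ψ * u) x| ≤ |u x| := fun x => by
    rw [Pi.mul_apply, abs_mul, abs_of_nonneg (hψ1 _).1]
    exact mul_le_of_le_one_left (abs_nonneg _) (hψ1 _).2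
  have hm : Measurable (ψ * u) := hψ.continuous.measurable.mul hu.measurable
  exact ⟨hm, ⟨T, fun x => (hmul x).trans (hT x)⟩,
    hu.integrable.mono hm.aestronglyMeasurable (ae_of_all _ hmul),
    ne_top_of_le_ne_top hH (lintegral_mono fun z => hle ψ hψ hψ1 z)⟩

end MusielakSobolev

namespace MusielakSobolev

variable {n : ℕ}

/-! ### Truncation of the values -/

/-- Truncation of `t` at height `T`, after removal of the values of size at most `δ`. -/
noncomputable def clip (δ T t : ℝ) : ℝ := max (-T) (min T t) - max (-δ) (min δ t)

theorem clip_zero {δ T : ℝ} (hδ : 0 ≤ δ) (hT : 0 ≤ T) : clip δ T 0 = 0 := by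
  simp [clip, hδ, hT]

/-- Both the clip and its complement $t-\mathrm{clip}(t)$ are nondecreasing, hence both are
1-Lipschitz. Thus neither has larger increments than $u$. -/
theorem clip_mono {δ T : ℝ} (hδ : 0 ≤ δ) (hδT : δ ≤ T) {t t' : ℝ} (h : t ≤ t') :
    clip δ T t ≤ clip δ T t' ∧ clip δ T t' - clip δ T t ≤ t' - t := by
  unfold clip
  constructor <;> grind

theorem abs_clip_sub_clip_le {δ T : ℝ} (hδ : 0 ≤ δ) (hδT : δ ≤ T) (t t' : ℝ) :
    |clip δ T t - clip δ T t'| ≤ |t - t'| := by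
  rcases le_total t t' with h | h
  · have := clip_mono hδ hδT h
    rw [abs_of_nonpos (by linarith), abs_of_nonpos (by linarith)]; linarith
  · have := clip_mono hδ hδT h
    rw [abs_of_nonneg (by linarith), abs_of_nonneg (by linarith)]; linarith

theorem abs_sub_clip_sub_le {δ T : ℝ} (hδ : 0 ≤ δ) (hδT : δ ≤ T) (t t' : ℝ) :
    |(t - clip δ T t) - (t' - clip δ T t')| ≤ |t - t'| := by
  rcases le_total t t' with h | h
  · have := clip_mono hδ hδT h
    rw [abs_of_nonpos (by linarith), abs_of_nonpos (by linarith)]; linarith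
  · have := clip_mono hδ hδT h
    rw [abs_of_nonneg (by linarith), abs_of_nonneg (by linarith)]; linarith

theorem abs_clip_le {δ T : ℝ} (hδ : 0 ≤ δ) (hδT : δ ≤ T) (t : ℝ) : |clip δ T t| ≤ T := by
  unfold clip
  rw [abs_le]
  constructor <;> grind

theorem clip_eq_zero {δ T : ℝ} (hδT : δ ≤ T) {t : ℝ} (ht : |t| ≤ δ) : clip δ T t = 0 := by
  rw [abs_le] at ht
  unfold clip
  grind

theorem abs_sub_clip_le {δ T : ℝ} (hδ : 0 ≤ δ) {t : ℝ} (ht : |t| ≤ T) :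
    |t - clip δ T t| ≤ δ := by
  rw [abs_le] at ht ⊢
  unfold clip
  constructor <;> grind

theorem continuous_clip (δ T : ℝ) : Continuous (clip δ T) := by
  unfold clip; fun_prop

variable {m : ℕ} {Q : ℝ → ℝ≥0∞} {P : E n → ℝ → ℝ≥0∞} {w : E n → ℝ≥0∞} {u v : E n → ℝ}

/-- Removing small values is what gives integrability: the clip vanishes for $|t|\le\delta$, and
elsewhere $Q(t)\ge Q(\delta)>0$, so $|\mathrm{clip}|\le (T/Q(\delta))\,Q$. -/
theorem isAdmissible_clip (hQ : IsModularDensity (n := n) m Q) (hQpos : ∀ t, t ≠ 0 → Q t ≠ 0)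
    (hP : IsGagliardoKernel m P w) (hu : Measurable u) (hE : energy Q P u ≠ ⊤) {δ T : ℝ}
    (hδ : 0 < δ) (hδT : δ ≤ T) : IsAdmissible P fun x => clip δ T (u x) := by
  have hm : Measurable fun x => clip δ T (u x) := (continuous_clip δ T).measurable.comp hu
  refine ⟨hm, ⟨T, fun x => abs_clip_le hδ.le hδT _⟩, ⟨hm.aestronglyMeasurable, ?_⟩, ?_⟩
  · rw [energy, ENNReal.add_ne_top] at hE
    have hb : ∀ t, ‖clip δ T t‖ₑ ≤ ENNReal.ofReal T / Q δ * Q t := by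
      intro t
      rcases le_total |t| δ with h | h
      · simp [clip_eq_zero hδT h]
      · have h1 : Q δ ≤ Q t := hQ.mono _ _ (by rwa [abs_of_pos hδ])
        rw [Real.enorm_eq_ofReal_abs]
        have hfin : Q δ ≠ ⊤ := by
          obtain ⟨B, hB⟩ := hQ.le_linear δ
          exact ne_top_of_le_ne_top (ENNReal.mul_ne_top ENNReal.coe_ne_top enorm_ne_top)
            (hB δ (abs_of_pos hδ).le)
        calc ENNReal.ofReal |clip δ T t| ≤ ENNReal.ofReal T :=
              ENNReal.ofReal_le_ofReal (abs_clip_le hδ.le hδT _)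
          _ = ENNReal.ofReal T / Q δ * Q δ :=
              (ENNReal.div_mul_cancel (hQpos δ hδ.ne') hfin).symm
          _ ≤ _ := by gcongr
    have hc : ENNReal.ofReal T / Q δ ≠ ⊤ := ENNReal.div_ne_top ENNReal.ofReal_ne_top (hQpos δ hδ.ne')
    refine (lintegral_mono fun x => hb (u x)).trans_lt ?_
    rw [lintegral_const_mul' _ _ hc]
    exact ENNReal.mul_lt_top hc.lt_top hE.1.lt_top
  · rw [energy, ENNReal.add_ne_top] at hE
    exact ne_top_of_le_ne_top hE.2 (lintegral_mono fun z => lintegral_mono fun y =>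
      (hP.density z).mono _ _ (abs_clip_sub_clip_le hδ.le hδT _ _))

theorem IsModularDensity.tendsto_zero {ρ : ℝ → ℝ≥0∞} (hρ : IsModularDensity (n := n) m ρ)
    {f : ℕ → ℝ} (hf : Tendsto f atTop (𝓝 0)) : Tendsto (fun k => ρ (f k)) atTop (𝓝 0) := by
  have := (hρ.continuous.tendsto 0).comp hf
  rwa [hρ.zero] at this

/-- As $u$ need be neither bounded nor integrable, dominated convergence is used on both integrals
directly. The integrands of $u$ itself dominate, because $t-\mathrm{clip}(t)$ is 1-Lipschitz and
vanishes at 0. -/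
theorem tendsto_energy_sub_clip (hQ : IsModularDensity (n := n) m Q)
    (hP : IsGagliardoKernel m P w) (hu : Measurable u) (hE : energy Q P u ≠ ⊤) :
    Tendsto (fun k : ℕ => energy Q P (u - fun x => clip (1 / (k + 1)) (k + 1) (u x)))
      atTop (𝓝 0) := by
  rw [energy, ENNReal.add_ne_top] at hE
  have hδ : ∀ k : ℕ, (0 : ℝ) ≤ 1 / (k + 1) := fun k => by positivity
  have hδT : ∀ k : ℕ, (1 : ℝ) / (k + 1) ≤ k + 1 := fun k => by
    have : (0 : ℝ) ≤ k := Nat.cast_nonneg k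
    rw [div_le_iff₀ (by positivity)]
    nlinarith
  have hpt : ∀ t : ℝ, Tendsto (fun k : ℕ => t - clip (1 / (k + 1)) (k + 1) t) atTop (𝓝 0) := by
    intro t
    refine squeeze_zero_norm' ?_ (tendsto_one_div_add_atTop_nhds_zero_nat (𝕜 := ℝ))
    obtain ⟨k₀, hk₀⟩ := exists_nat_ge |t|
    filter_upwards [eventually_ge_atTop k₀] with k hk
    refine abs_sub_clip_le (hδ k) (hk₀.trans ?_)
    have : (k₀ : ℝ) ≤ k := Nat.cast_le.2 hk
    linarith
  have hm : ∀ k : ℕ, Measurable (u - fun x => clip (1 / (k + 1)) (k + 1) (u x)) := fun k =>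
    hu.sub ((continuous_clip _ _).measurable.comp hu)
  have h1 := tendsto_lintegral_of_dominated_convergence (μ := volume)
    (F := fun (k : ℕ) x => Q ((u - fun x => clip (1 / (k + 1)) (k + 1) (u x)) x))
    (f := fun _ => 0) (fun x => Q (u x)) (fun k => hQ.continuous.measurable.comp (hm k))
    (fun k => ae_of_all _ fun x => by
      refine hQ.mono _ _ ?_
      have h := abs_sub_clip_sub_le (hδ k) (hδT k) (u x) 0
      rwa [clip_zero (hδ k) ((hδ k).trans (hδT k)), sub_self, sub_zero, sub_zero] at h)
    hE.1 (ae_of_all _ fun x => hQ.tendsto_zero (hpt (u x)))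
  have h2 := tendsto_lintegral_of_dominated_convergence'
    (μ := (volume : Measure (E n)).prod volume)
    (F := fun (k : ℕ) p => P p.1 ((u - fun x => clip (1 / (k + 1)) (k + 1) (u x)) (p.2 + p.1)
      - (u - fun x => clip (1 / (k + 1)) (k + 1) (u x)) p.2))
    (f := fun _ => 0) (fun p => P p.1 (u (p.2 + p.1) - u p.2))
    (fun k => hP.aemeasurable_prod (hm k))
    (fun k => ae_of_all _ fun p => (hP.density p.1).mono _ _
      (abs_sub_clip_sub_le (hδ k) (hδT k) _ _))
    (by rw [lintegral_prod _ (hP.aemeasurable_prod hu)]; exact hE.2)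
    (ae_of_all _ fun p => (hP.density p.1).tendsto_zero (by
      simpa using (hpt (u (p.2 + p.1))).sub (hpt (u p.2))))
  have h3 := h1.add h2
  simp only [lintegral_zero, add_zero] at h3
  refine h3.congr fun k => ?_
  rw [lintegral_prod _ (hP.aemeasurable_prod (hm k))]
  rfl

/-! ### Truncation of the support -/

theorem lipschitzWith_radialCutoff {V : Type*} [SeminormedAddCommGroup V] (c : V) {r : ℝ}
    (hr : 0 < r) :
    LipschitzWith (Real.toNNReal r⁻¹) fun x => max 0 (min 1 (2 - ‖x - c‖ / r)) := by
  have h : LipschitzWith (Real.toNNReal r⁻¹) fun x : V => 2 - ‖x - c‖ / r := by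
    refine LipschitzWith.of_dist_le_mul fun x y => ?_
    rw [Real.coe_toNNReal _ (by positivity), Real.dist_eq, dist_eq_norm]
    have h1 : 2 - ‖x - c‖ / r - (2 - ‖y - c‖ / r) = r⁻¹ * (‖y - c‖ - ‖x - c‖) := by
      field_simp; ring
    rw [h1, abs_mul, abs_of_pos (inv_pos.2 hr)]
    refine mul_le_mul_of_nonneg_left ((abs_norm_sub_norm_le _ _).trans_eq ?_) (by positivity)
    rw [sub_sub_sub_cancel_right, norm_sub_rev]
  exact (h.const_min 1).const_max 0

theorem radialCutoff_mem {V : Type*} [SeminormedAddCommGroup V] (c : V) (r : ℝ) (x : V) :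
    max 0 (min 1 (2 - ‖x - c‖ / r)) ∈ Icc (0 : ℝ) 1 :=
  ⟨le_max_left _ _, max_le zero_le_one (min_le_left _ _)⟩

theorem radialCutoff_eq_one {V : Type*} [SeminormedAddCommGroup V] {c : V} {r : ℝ} (hr : 0 < r)
    {x : V} (hx : ‖x - c‖ ≤ r) : max 0 (min 1 (2 - ‖x - c‖ / r)) = 1 := by
  have : ‖x - c‖ / r ≤ 1 := (div_le_one hr).2 hx
  rw [min_eq_left (by linarith), max_eq_right zero_le_one]

theorem radialCutoff_eq_zero {V : Type*} [SeminormedAddCommGroup V] {c : V} {r : ℝ} (hr : 0 < r)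
    {x : V} (hx : 2 * r ≤ ‖x - c‖) : max 0 (min 1 (2 - ‖x - c‖ / r)) = 0 := by
  have : 2 ≤ ‖x - c‖ / r := (le_div_iff₀ hr).2 hx
  rw [max_eq_left ((min_le_right _ _).trans (by linarith))]

theorem IsAdmissible.tendsto_energy_sub_cutoff (hQ : IsModularDensity (n := n) m Q)
    (hP : IsGagliardoKernel m P w) (hu : IsAdmissible P u) :
    Tendsto (fun k : ℕ => energy Q P
      (u - (fun x : E n => max 0 (min 1 (2 - ‖x - 0‖ / ((k : ℝ) + 1)))) * u)) atTop (𝓝 0) := by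
  set ψ : ℕ → E n → ℝ := fun k x => max 0 (min 1 (2 - ‖x - 0‖ / ((k : ℝ) + 1))) with hψdef
  have hk : ∀ k : ℕ, (0 : ℝ) < k + 1 := fun k => by positivity
  have hψ1 : ∀ k x, ψ k x ∈ Icc (0 : ℝ) 1 := fun k x => radialCutoff_mem 0 _ x
  -- The radii are at least 1, so one Lipschitz constant, and hence one dominating function, serves
  -- all $k$.
  have hψL : ∀ k, LipschitzWith 1 (ψ k) := fun k =>
    (lipschitzWith_radialCutoff (0 : E n) (hk k)).weaken (by
      rw [Real.toNNReal_le_one]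
      exact inv_le_one_of_one_le₀ (by linarith [(Nat.cast_nonneg k : (0 : ℝ) ≤ k)]))
  have hone : ∀ x, ∀ᶠ k in atTop, ψ k x = 1 := fun x => by
    obtain ⟨k₀, hk₀⟩ := exists_nat_ge ‖x‖
    filter_upwards [eventually_ge_atTop k₀] with k hkk
    refine radialCutoff_eq_one (hk k) ?_
    have : (k₀ : ℝ) ≤ k := Nat.cast_le.2 hkk
    rw [sub_zero]; linarith
  obtain ⟨H, hH, hle⟩ := hu.exists_dominating_mul hP 1
  obtain ⟨T, hT⟩ := hu.bounded
  have hmul : ∀ k x, |(ψ k * u) x| ≤ |u x| := fun k x => by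
    rw [Pi.mul_apply, abs_mul, abs_of_nonneg (hψ1 k _).1]
    exact mul_le_of_le_one_left (abs_nonneg _) (hψ1 k _).2
  have hm : ∀ k, Measurable (ψ k * u) := fun k => (hψL k).continuous.measurable.mul hu.measurable
  refine tendsto_energy_of_dominated hQ hP hu.measurable hm hT
    (fun k x => (hmul k x).trans (hT x)) ?_ hH (fun z => ?_)
    (fun k z => hle (ψ k) (hψL k) (hψ1 k) z)
  · have h := tendsto_lintegral_of_dominated_convergence (μ := volume)
      (F := fun k x => ‖u x - (ψ k * u) x‖ₑ) (f := fun _ => 0) (fun x => ‖u x‖ₑ)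
      (fun k => (hu.measurable.sub (hm k)).enorm) (fun k => ae_of_all _ fun x => ?_)
      hu.integrable.hasFiniteIntegral.ne (ae_of_all _ fun x => ?_)
    · rwa [lintegral_zero] at h
    · simp only [Pi.mul_apply]
      rw [Real.enorm_eq_ofReal_abs, Real.enorm_eq_ofReal_abs]
      refine ENNReal.ofReal_le_ofReal ?_
      rw [show u x - ψ k x * u x = (1 - ψ k x) * u x by ring, abs_mul,
        abs_of_nonneg (sub_nonneg.2 (hψ1 k x).2)]
      exact mul_le_of_le_one_left (abs_nonneg _) (by linarith [(hψ1 k x).1])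
    · refine tendsto_const_nhds.congr' ?_
      filter_upwards [hone x] with k hk
      simp [hk]
  -- The same function dominates $u$, seen as its product with the constant cutoff 1.
  · have := hle (fun _ => 1) (LipschitzWith.const _ |>.weaken zero_le) (fun _ => by simp) z
    have h1 : (fun _ => (1 : ℝ)) * u = u := one_mul u
    rwa [h1] at this

end MusielakSobolev

namespace MusielakSobolev

variable {n : ℕ} {m : ℕ} {Q : ℝ → ℝ≥0∞} {P : E n → ℝ → ℝ≥0∞} {w : E n → ℝ≥0∞} {u v : E n → ℝ}

/-! ### Mollification -/

/-- Continuity of translations in `L¹`. -/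
theorem exists_lintegral_translate_le (hv : Integrable v) {δ : ℝ≥0∞} (hδ : δ ≠ 0) :
    ∃ η > 0, ∀ t : E n, ‖t‖ < η → ∫⁻ x, ‖v x - v (x - t)‖ₑ ≤ δ := by
  have hmem : MemLp v 1 := memLp_one_iff_integrable.2 hv
  have hmp : ∀ t : E n, MeasurePreserving (fun x : E n => x - t) volume volume := fun t =>
    measurePreserving_sub_right volume t
  let γ : C(E n × E n, E n) := ⟨fun p => p.2 - p.1, by fun_prop⟩
  have hmpγ : ∀ t : E n, MeasurePreserving (γ.curry t) volume volume := hmp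
  have h := (tendsto_const_nhds (x := hmem.toLp v) (f := 𝓝 (0 : E n))).compMeasurePreservingLp
    (γ.curry.continuous.tendsto 0) hmpγ (hmpγ 0) ENNReal.one_ne_top
  have h2 := EMetric.tendsto_nhds.1 h δ (pos_iff_ne_zero.2 hδ)
  obtain ⟨η, hη, hball⟩ := Metric.eventually_nhds_iff.1 h2
  refine ⟨η, hη, fun t ht => ?_⟩
  have h3 := hball (y := t) (by simpa using ht)
  rw [Lp.toLp_compMeasurePreserving, Lp.toLp_compMeasurePreserving, edist_comm,
    Lp.edist_toLp_toLp, eLpNorm_one_eq_lintegral_enorm] at h3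
  refine le_of_eq_of_le ?_ h3.le
  refine lintegral_congr fun x => ?_
  simp [γ]

theorem measurable_average (μ : Measure (E n)) [SFinite μ] (hv : Measurable v) :
    Measurable fun x => ∫ t, v (x - t) ∂μ := by
  have : StronglyMeasurable (Function.uncurry fun x t : E n => v (x - t)) :=
    (hv.comp (measurable_fst.sub measurable_snd)).stronglyMeasurable
  exact this.integral_prod_right.measurable

theorem integrable_translate (μ : Measure (E n)) [IsFiniteMeasure μ] (hv : Measurable v) {T : ℝ}
    (hT : ∀ x, |v x| ≤ T) (x : E n) : Integrable (fun t => v (x - t)) μ :=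
  Integrable.of_bound (hv.comp (measurable_const.sub measurable_id)).aestronglyMeasurable T
    (ae_of_all _ fun _ => hT _)

theorem abs_average_le (μ : Measure (E n)) [IsProbabilityMeasure μ] {T : ℝ}
    (hT : ∀ x, |v x| ≤ T) (x : E n) : |∫ t, v (x - t) ∂μ| ≤ T := by
  have := norm_integral_le_of_norm_le_const (μ := μ) (f := fun t => v (x - t)) (C := T)
    (ae_of_all _ fun t => hT (x - t))
  simpa using this

theorem lintegral_sub_average_le (μ : Measure (E n)) [IsProbabilityMeasure μ]
    (hv : Measurable v) {T : ℝ} (hT : ∀ x, |v x| ≤ T) {δ : ℝ≥0∞}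
    (hδ : ∀ᵐ t ∂μ, ∫⁻ x, ‖v x - v (x - t)‖ₑ ≤ δ) :
    ∫⁻ x, ‖v x - ∫ t, v (x - t) ∂μ‖ₑ ≤ δ := by
  calc ∫⁻ x, ‖v x - ∫ t, v (x - t) ∂μ‖ₑ ≤ ∫⁻ x, ∫⁻ t, ‖v x - v (x - t)‖ₑ ∂μ := by
        refine lintegral_mono fun x => ?_
        have h : v x - ∫ t, v (x - t) ∂μ = ∫ t, (v x - v (x - t)) ∂μ := by
          rw [integral_sub (integrable_const _) (integrable_translate μ hv hT x)]
          simp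
        rw [h]
        exact enorm_integral_le_lintegral_enorm _
    _ = ∫⁻ t, (∫⁻ x, ‖v x - v (x - t)‖ₑ) ∂μ := by
        refine lintegral_lintegral_swap (Measurable.aemeasurable ?_)
        exact ((hv.comp measurable_fst).sub
          (hv.comp (measurable_fst.sub measurable_snd))).enorm
    _ ≤ ∫⁻ _, δ ∂μ := lintegral_mono_ae hδ
    _ = δ := by simp

/-- An increment of the average is the average of the increments. Jensen's inequality, Tonelli's
theorem and translation invariance in $y$ conclude, since $P_z$ does not depend on $y$. -/
theorem IsGagliardoKernel.incrementModular_average_le (hP : IsGagliardoKernel m P w)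
    (μ : Measure (E n)) [IsProbabilityMeasure μ] (hv : Measurable v) {T : ℝ}
    (hT : ∀ x, |v x| ≤ T) (z : E n) :
    incrementModular P (fun x => ∫ t, v (x - t) ∂μ) z ≤ incrementModular P v z := by
  calc incrementModular P (fun x => ∫ t, v (x - t) ∂μ) z
      ≤ ∫⁻ y, ∫⁻ t, P z (v (y + z - t) - v (y - t)) ∂μ := by
        refine lintegral_mono fun y => ?_
        simp only
        rw [← integral_sub (integrable_translate μ hv hT _) (integrable_translate μ hv hT _)]
        refine (hP.density z).jensen μ _ (T + T) ?_ fun t => ?_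
        · exact (hv.comp (measurable_const.sub measurable_id)).sub
            (hv.comp (measurable_const.sub measurable_id))
        · exact (abs_sub _ _).trans (add_le_add (hT _) (hT _))
    _ = ∫⁻ t, (∫⁻ y, P z (v (y + z - t) - v (y - t))) ∂μ := by
        refine lintegral_lintegral_swap (Measurable.aemeasurable ?_)
        exact (hP.density z).continuous.measurable.comp
          ((hv.comp ((measurable_fst.add_const z).sub measurable_snd)).sub
            (hv.comp (measurable_fst.sub measurable_snd)))
    _ = ∫⁻ _, incrementModular P v z ∂μ := by
        refine lintegral_congr fun t => ?_
        have := lintegral_sub_right_eq_self (μ := (volume : Measure (E n)))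
          (fun y => P z (v (y + z) - v y)) t
        rw [incrementModular, ← this]
        refine lintegral_congr fun y => ?_
        rw [sub_add_eq_add_sub]
    _ = incrementModular P v z := by simp

theorem energy_zero (hQ : IsModularDensity (n := n) m Q) (hP : IsGagliardoKernel m P w) :
    energy Q P 0 = 0 := by
  simp [energy, incrementModular, hQ.zero, (hP.density _).zero]

theorem isSmoothLimit_of_mem {Ω : Set (E n)} (hQ : IsModularDensity (n := n) m Q)
    (hP : IsGagliardoKernel m P w) {φ : E n → ℝ} (hφ : φ ∈ CcInfty Ω) :
    IsSmoothLimit Q P Ω φ := fun δ _ => ⟨φ, hφ, by rw [sub_self, energy_zero hQ hP]; exact zero_le⟩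

/-- A function whose support can be pushed into `Ω` by arbitrarily small translations is a
limit of functions of `C_0^∞(Ω)`. -/
theorem IsAdmissible.isSmoothLimit_of_translate {Ω : Set (E n)} (hΩ : IsOpen Ω)
    (hQ : IsModularDensity (n := n) m Q) (hP : IsGagliardoKernel m P w) (hv : IsAdmissible P v)
    {K : Set (E n)} (hK : IsCompact K) (hvK : ∀ x ∉ K, v x = 0)
    (hpush : ∀ η > 0, ∃ h : E n, ‖h‖ < η ∧ ∀ x ∈ K, h + x ∈ Ω) : IsSmoothLimit Q P Ω v := by
  -- The bump is centred at `h`, not at 0, so convolution with it both translates by `h` and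
  -- smooths. Its radius is small enough to keep the result supported in $\Omega$.
  have hsel : ∀ k : ℕ, ∃ (h : E n) (f : ContDiffBump h), ‖h‖ + f.rOut < 2 / (k + 1) ∧
      Metric.cthickening f.rOut ((h + ·) '' K) ⊆ Ω := by
    intro k
    have hk : (0 : ℝ) < 1 / (k + 1) := by positivity
    obtain ⟨h, hh, hhK⟩ := hpush _ hk
    obtain ⟨r, hr, hrΩ⟩ := (hK.image (continuous_const_add h)).exists_cthickening_subset_open hΩ
      (image_subset_iff.2 hhK)
    have hr' : 0 < min r (1 / (k + 1)) := lt_min hr hk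
    refine ⟨h, ⟨min r (1 / (k + 1)) / 2, min r (1 / (k + 1)), by positivity,
      half_lt_self hr'⟩, ?_, ?_⟩
    · have : min r (1 / ((k : ℝ) + 1)) ≤ 1 / (k + 1) := min_le_right _ _
      have h2 : (2 : ℝ) / (k + 1) = 1 / (k + 1) + 1 / (k + 1) := by ring
      simp only
      linarith
    · exact (Metric.cthickening_mono (min_le_left _ _) _).trans hrΩ
  choose h f hhf hfΩ using hsel
  obtain ⟨T, hT⟩ := hv.bounded
  -- As averages against a probability measure, the mollifications obey Jensen's inequality; as
  -- convolutions (`hconv`), they are smooth.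
  set μ : ℕ → Measure (E n) := fun k =>
    volume.withDensity fun t => ENNReal.ofReal ((f k).normed volume t) with hμ
  have hprob : ∀ k, IsProbabilityMeasure (μ k) := fun k => ⟨by
    rw [hμ]
    simp only
    rw [withDensity_apply _ MeasurableSet.univ, Measure.restrict_univ,
      ← ofReal_integral_eq_lintegral_ofReal (f k).integrable_normed
        (ae_of_all _ fun t => (f k).nonneg_normed t), (f k).integral_normed, ENNReal.ofReal_one]⟩
  have hconv : ∀ k, (fun x => ∫ t, v (x - t) ∂(μ k)) =
      convolution ((f k).normed volume) v (ContinuousLinearMap.lsmul ℝ ℝ) volume := by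
    intro k
    ext x
    rw [hμ]
    simp only
    rw [integral_withDensity_eq_integral_toReal_smul
      (f k).continuous_normed.measurable.ennreal_ofReal (by simp)]
    simp only [convolution, ContinuousLinearMap.lsmul_apply,
      ENNReal.toReal_ofReal ((f k).nonneg_normed _)]
  have hmem : ∀ k, (fun x => ∫ t, v (x - t) ∂(μ k)) ∈ CcInfty Ω := by
    intro k
    have hsupp : tsupport (fun x => ∫ t, v (x - t) ∂(μ k)) ⊆
        Metric.cthickening (f k).rOut ((h k + ·) '' K) := by
      refine closure_minimal ?_ Metric.isClosed_cthickening
      rw [hconv]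
      refine (support_convolution_subset _).trans ?_
      rintro _ ⟨t, ht, x, hx, rfl⟩
      rw [(f k).support_normed_eq] at ht
      have hxK : x ∈ K := by
        by_contra hxK
        exact hx (hvK x hxK)
      refine Metric.mem_cthickening_of_dist_le _ (h k + x) _ _ (mem_image_of_mem _ hxK) ?_
      simpa [dist_add_right] using (Metric.mem_ball.1 ht).le
    refine ⟨?_, ?_, hsupp.trans (hfΩ k)⟩
    · rw [hconv]
      exact (f k).hasCompactSupport_normed.contDiff_convolution_left _ (f k).contDiff_normed
        hv.integrable.locallyIntegrable
    · exact ((hK.image (continuous_const_add (h k))).cthickening).of_isClosed_subset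
        (isClosed_tsupport _) hsupp
  refine .of_tendsto hQ hP hv.measurable (U := fun k x => ∫ t, v (x - t) ∂(μ k))
    (fun k => measurable_average _ hv.measurable) (fun k => isSmoothLimit_of_mem hQ hP (hmem k)) ?_
  refine tendsto_energy_of_dominated hQ hP hv.measurable
    (fun k => measurable_average _ hv.measurable) hT (fun k x => abs_average_le _ hT x) ?_
    hv.lintegral_ne_top (fun z => le_rfl)
    (fun k z => hP.incrementModular_average_le _ hv.measurable hT z)
  refine ENNReal.tendsto_nhds_zero.2 fun δ hδ => ?_
  obtain ⟨η, hη, hle⟩ := exists_lintegral_translate_le hv.integrable hδ.ne'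
  have hlim : Tendsto (fun k : ℕ => (2 : ℝ) / (k + 1)) atTop (𝓝 0) := by
    have := (tendsto_one_div_add_atTop_nhds_zero_nat (𝕜 := ℝ)).const_mul 2
    simpa [div_eq_mul_inv] using this
  filter_upwards [hlim.eventually (gt_mem_nhds hη)] with k hk
  refine lintegral_sub_average_le _ hv.measurable hT ?_
  have hmeas : Measurable fun t => ENNReal.ofReal ((f k).normed volume t) :=
    (f k).continuous_normed.measurable.ennreal_ofReal
  refine (ae_withDensity_iff hmeas).2 (ae_of_all _ fun t ht => hle t ?_)
  have ht2 : t ∈ Function.support ((f k).normed volume) := fun h0 => ht (by simp [h0])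
  rw [(f k).support_normed_eq, Metric.mem_ball, dist_eq_norm] at ht2
  have h4 := norm_le_norm_add_norm_sub' t (h k)
  linarith [hhf k]

end MusielakSobolev

namespace MusielakSobolev

variable {n : ℕ} {m : ℕ} {Q : ℝ → ℝ≥0∞} {P : E n → ℝ → ℝ≥0∞} {w : E n → ℝ≥0∞} {u v : E n → ℝ}

/-! ### Open sets with continuous boundary -/

theorem closure_hypograph_subset {ξ : EuclideanSpace ℝ (Fin n) → ℝ} (hξ : Continuous ξ) :
    closure (hypograph ξ) ⊆
      {x : E n | x (Fin.last n) ≤ ξ (WithLp.toLp 2 fun i : Fin n => x i.castSucc)} :=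
  closure_minimal (fun x (hx : x (Fin.last n) < ξ _) => hx.le)
    (isClosed_le (by fun_prop) (hξ.comp (by fun_prop)))

/-- On the closure the defining inequality is only weak. Lowering the last coordinate makes it
strict and leaves the argument of $\xi$ unchanged. -/
theorem sub_single_mem_hypograph {ξ : EuclideanSpace ℝ (Fin n) → ℝ} (hξ : Continuous ξ)
    {x : E n} (hx : x ∈ closure (hypograph ξ)) {τ : ℝ} (hτ : 0 < τ) :
    x - EuclideanSpace.single (Fin.last n) τ ∈ hypograph ξ := by
  have h := closure_hypograph_subset hξ hx
  have h' : (x : E n) (Fin.last n) ≤ ξ (WithLp.toLp 2 fun i : Fin n => x i.castSucc) := h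
  have h2 : ∀ i : Fin n, (x - EuclideanSpace.single (Fin.last n) τ : E n) i.castSucc
      = x i.castSucc := fun i => by
    simp [(Fin.castSucc_lt_last i).ne]
  simp only [hypograph, mem_ofPred_eq, h2]
  simp only [PiLp.sub_apply, PiLp.single_apply, if_true]
  linarith

/-- Near a continuous boundary, small translations push compact pieces of `closure Ω` into `Ω`. -/
theorem exists_translate_subset {Ω W Ωl : Set (E n)} {ξ : EuclideanSpace ℝ (Fin n) → ℝ}
    {R : E n ≃ᵃⁱ[ℝ] E n} (hW : IsOpen W) (hξ : Continuous ξ) (hR : R '' Ωl = hypograph ξ)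
    (hWΩ : W ∩ Ω = W ∩ Ωl) {K : Set (E n)} (hK : IsCompact K) (hKW : K ⊆ W)
    (hKΩ : K ⊆ closure Ω) {η : ℝ} (hη : 0 < η) :
    ∃ h : E n, ‖h‖ < η ∧ ∀ x ∈ K, h + x ∈ Ω := by
  obtain ⟨δ, hδ, hδW⟩ := hK.exists_cthickening_subset_open hW hKW
  have hτ : 0 < min η δ / 2 := by positivity
  -- A shift shorter than `δ` keeps `K` inside `W`, where $\Omega$ and the chart set coincide.
  set τ := min η δ / 2 with hτdef
  have hτη : τ < η := (half_lt_self (lt_min hη hδ)).trans_le (min_le_left _ _)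
  have hτδ : τ < δ := (half_lt_self (lt_min hη hδ)).trans_le (min_le_right _ _)
  set h : E n := R.linearIsometryEquiv.symm (-EuclideanSpace.single (Fin.last n) τ) with hh
  have hnorm : ‖h‖ = τ := by
    rw [hh, LinearIsometryEquiv.norm_map, norm_neg, PiLp.norm_single,
      Real.norm_of_nonneg hτ.le]
  refine ⟨h, hnorm.trans_lt hτη, fun x hx => ?_⟩
  have hxW : h + x ∈ W := hδW (Metric.mem_cthickening_of_dist_le _ x _ _ hx (by
    rw [dist_add_self_left, hnorm]; exact hτδ.le))
  have hcl : R x ∈ closure (hypograph ξ) := by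
    rw [← hR]
    have h1 : x ∈ closure Ωl := by
      -- Since `W` is open, a point of $W\cap\overline\Omega$ lies in
      -- $\overline{W\cap\Omega}=\overline{W\cap\Omega_l}$.
      have h2 := hW.inter_closure ⟨hKW hx, hKΩ hx⟩
      rw [hWΩ] at h2
      exact closure_mono inter_subset_right h2
    exact image_closure_subset_closure_image R.continuous (mem_image_of_mem _ h1)
  have hmem := sub_single_mem_hypograph hξ hcl hτ
  have hRh : R (h + x) = R x - EuclideanSpace.single (Fin.last n) τ := by
    have := R.map_vadd x h
    rw [vadd_eq_add, vadd_eq_add, hh, LinearIsometryEquiv.apply_symm_apply] at this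
    rw [hh, this]
    abel
  rw [← hRh, ← hR] at hmem
  obtain ⟨y, hy, hyx⟩ := hmem
  rw [R.injective hyx] at hy
  exact (hWΩ.symm.subset ⟨hxW, hy⟩).2

/-- Induction on the balls still needed to cover $\partial\Omega$, with `V` an open set where $u$
already vanishes. For a ball with cutoff $\psi$, the piece $\psi u$ lives in the doubled ball and is
pushed inward, while $(1-\psi)u$ also vanishes on the ball, which joins `V`. -/
theorem IsAdmissible.isSmoothLimit_of_finite_cover {Ω : Set (E n)} (hΩ : IsOpen Ω)
    (hQ : IsModularDensity (n := n) m Q) (hP : IsGagliardoKernel m P w)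
    {r : E n → ℝ} (hr : ∀ c, 0 < r c)
    (hpush : ∀ c ∈ frontier Ω, ∀ K, IsCompact K → K ⊆ Metric.closedBall c (2 * r c) →
      K ⊆ closure Ω → ∀ η > 0, ∃ h : E n, ‖h‖ < η ∧ ∀ x ∈ K, h + x ∈ Ω)
    {B : Set (E n)} (hB : IsCompact B) (t : Finset (E n)) (ht : ∀ c ∈ t, c ∈ frontier Ω)
    (hu : IsAdmissible P u) (huΩ : ∀ x ∉ Ω, u x = 0) (huB : ∀ x ∉ B, u x = 0)
    {V : Set (E n)} (hV : IsOpen V) (huV : ∀ x ∈ V, u x = 0)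
    (hcover : frontier Ω ⊆ V ∪ ⋃ c ∈ t, Metric.ball c (r c)) : IsSmoothLimit Q P Ω u := by
  classical
  induction t using Finset.induction_on generalizing u V with
  | empty =>
    -- No ball is left, so $\partial\Omega\subseteq V$: the compact set carrying $u$ lies in
    -- $\Omega$ and the zero translation suffices.
    refine hu.isSmoothLimit_of_translate hΩ hQ hP
      (K := (B ∩ closure Ω) \ V) ((hB.inter_right isClosed_closure).diff hV) (fun x hx => ?_)
      fun η hη => ⟨0, by simpa using hη, fun x hx => ?_⟩
    · by_contra h0
      refine hx ⟨⟨by_contra fun h => h0 (huB x h), subset_closure (by_contra fun h => h0 (huΩ x h))⟩,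
        fun h => h0 (huV x h)⟩
    · rw [zero_add]
      by_contra hxΩ
      have hf : x ∈ frontier Ω := by
        rw [hΩ.frontier_eq]
        exact ⟨hx.1.2, hxΩ⟩
      have := hcover hf
      simp only [Finset.notMem_empty, iUnion_of_empty, iUnion_empty, union_empty] at this
      exact hx.2 this
  | insert c t hc ih =>
    set ψ : E n → ℝ := fun x => max 0 (min 1 (2 - ‖x - c‖ / r c))
    have hψL : LipschitzWith (Real.toNNReal (r c)⁻¹) ψ := lipschitzWith_radialCutoff c (hr c)
    have hψ1 : ∀ x, ψ x ∈ Icc (0 : ℝ) 1 := radialCutoff_mem c (r c)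
    have hψL' : LipschitzWith (Real.toNNReal (r c)⁻¹) (1 - ψ) := by
      have := (LipschitzWith.const (α := E n) (1 : ℝ)).sub hψL
      rwa [zero_add] at this
    have hψ1' : ∀ x, (1 - ψ) x ∈ Icc (0 : ℝ) 1 := fun x => by
      simp only [Pi.sub_apply, Pi.one_apply]
      exact ⟨by linarith [(hψ1 x).2], by linarith [(hψ1 x).1]⟩
    have h1 := hu.mul hP hψL hψ1
    have h2 := hu.mul hP hψL' hψ1'
    have hsplit : ψ * u + (1 - ψ) * u = u := by rw [← add_mul]; simp
    rw [← hsplit]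
    refine IsSmoothLimit.add hQ hP h1.measurable ?_ ?_
    · refine h1.isSmoothLimit_of_translate hΩ hQ hP
        (K := Metric.closedBall c (2 * r c) ∩ closure Ω)
        ((isCompact_closedBall c _).inter_right isClosed_closure) (fun x hx => ?_)
        (hpush c (ht c (Finset.mem_insert_self _ _)) _
          ((isCompact_closedBall c _).inter_right isClosed_closure) inter_subset_left
          inter_subset_right)
      by_contra h0
      rw [Pi.mul_apply] at h0
      refine hx ⟨?_, subset_closure (by_contra fun h => h0 (by rw [huΩ x h, mul_zero]))⟩
      by_contra h
      rw [Metric.mem_closedBall, dist_eq_norm, not_le] at h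
      exact h0 (by rw [show ψ x = 0 from radialCutoff_eq_zero (hr c) h.le, zero_mul])
    · refine ih (fun c' hc' => ht c' (Finset.mem_insert_of_mem hc')) h2
        (fun x hx => by rw [Pi.mul_apply, huΩ x hx, mul_zero])
        (fun x hx => by rw [Pi.mul_apply, huB x hx, mul_zero])
        (hV.union (Metric.isOpen_ball (x := c) (ε := r c))) ?_ ?_
      · rintro x (hx | hx)
        · rw [Pi.mul_apply, huV x hx, mul_zero]
        · rw [Metric.mem_ball, dist_eq_norm] at hx
          rw [Pi.mul_apply, Pi.sub_apply,
            show ψ x = 1 from radialCutoff_eq_one (hr c) hx.le]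
          simp
      · refine hcover.trans ?_
        rw [Finset.set_biUnion_insert, union_assoc]

/-- Measurable functions of finite energy which vanish outside an open set with continuous
boundary are limits of smooth functions with compact support in the set. -/
theorem isSmoothLimit_of_energy_ne_top {Ω : Set (E n)} (hΩ : IsOpen Ω)
    (hbd : HasContinuousBoundary Ω) (hQ : IsModularDensity (n := n) m Q)
    (hQpos : ∀ t, t ≠ 0 → Q t ≠ 0) (hP : IsGagliardoKernel m P w) (hu : Measurable u)
    (huΩ : ∀ x ∉ Ω, u x = 0) (hE : energy Q P u ≠ ⊤) : IsSmoothLimit Q P Ω u := by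
  obtain ⟨hcomp, M, W, Ωl, ξ, R, hW, hξ, hcov, hR, hWΩ⟩ := hbd
  have hrad : ∀ c : E n, ∃ r : ℝ, 0 < r ∧
      (c ∈ frontier Ω → ∃ j, Metric.closedBall c (2 * r) ⊆ W j) := by
    intro c
    by_cases hc : c ∈ frontier Ω
    · obtain ⟨j, hj⟩ := mem_iUnion.1 (hcov hc)
      obtain ⟨ε, hε, hεW⟩ := Metric.nhds_basis_closedBall.mem_iff.1 ((hW j).mem_nhds hj)
      exact ⟨ε / 2, half_pos hε, fun _ => ⟨j, by rwa [mul_div_cancel₀ _ two_ne_zero]⟩⟩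
    · exact ⟨1, one_pos, fun h => absurd h hc⟩
  choose r hr hrW using hrad
  have hpush : ∀ c ∈ frontier Ω, ∀ K, IsCompact K → K ⊆ Metric.closedBall c (2 * r c) →
      K ⊆ closure Ω → ∀ η > 0, ∃ h : E n, ‖h‖ < η ∧ ∀ x ∈ K, h + x ∈ Ω := by
    intro c hc K hK hKc hKΩ η hη
    obtain ⟨j, hj⟩ := hrW c hc
    exact exists_translate_subset (hW j) (hξ j) (hR j) (hWΩ j) hK (hKc.trans hj) hKΩ hη
  obtain ⟨t, ht, htcov⟩ := hcomp.elim_nhds_subcover (fun c => Metric.ball c (r c))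
    fun c _ => Metric.ball_mem_nhds c (hr c)
  have hpos : ∀ k : ℕ, (0 : ℝ) < 1 / (k + 1) := fun k => by positivity
  have hle : ∀ k : ℕ, (1 : ℝ) / (k + 1) ≤ k + 1 := fun k => by
    have : (0 : ℝ) ≤ k := Nat.cast_nonneg k
    rw [div_le_iff₀ (by positivity)]
    nlinarith
  refine .of_tendsto hQ hP hu
    (fun k => ((continuous_clip _ _).measurable.comp hu)) (fun k => ?_)
    (tendsto_energy_sub_clip hQ hP hu hE)
  have hadm := isAdmissible_clip hQ hQpos hP hu hE (hpos k) (hle k)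
  set v : E n → ℝ := fun x => clip (1 / (k + 1)) (k + 1) (u x)
  have hvΩ : ∀ x ∉ Ω, v x = 0 := fun x hx => by
    simp only [v, huΩ x hx]
    exact clip_zero (hpos k).le ((hpos k).le.trans (hle k))
  have hadm' : ∀ l : ℕ, IsAdmissible P
      ((fun x : E n => max 0 (min 1 (2 - ‖x - 0‖ / ((l : ℝ) + 1)))) * v) := fun l =>
    hadm.mul hP (lipschitzWith_radialCutoff 0 (by positivity)) (radialCutoff_mem 0 _)
  refine .of_tendsto hQ hP hadm.measurable (fun l => (hadm' l).measurable) (fun l => ?_)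
    (hadm.tendsto_energy_sub_cutoff hQ hP)
  refine (hadm' l).isSmoothLimit_of_finite_cover hΩ hQ hP hr hpush
    (isCompact_closedBall (0 : E n) (2 * (l + 1))) t ht
    (fun x hx => by rw [Pi.mul_apply, hvΩ x hx, mul_zero]) (fun x hx => ?_)
    isOpen_empty (fun x hx => absurd hx (notMem_empty x)) (by rwa [empty_union])
  rw [Metric.mem_closedBall, dist_eq_norm, not_le] at hx
  rw [Pi.mul_apply, radialCutoff_eq_zero (by positivity) hx.le, zero_mul]

end MusielakSobolev

namespace MusielakSobolev

variable {n : ℕ} {m : ℕ} {Q : ℝ → ℝ≥0∞} {P : E n → ℝ → ℝ≥0∞} {w : E n → ℝ≥0∞} {u v : E n → ℝ}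

/-! ### Smooth functions have finite energy -/

/-- An increment of $\varphi$ vanishes unless $y$ or $y+z$ lies in the compact support. It is thus
at most $(g(y)+g(y+z))\min(1,|z|)$, with $g$ a multiple of the indicator of the support, and the
weight applies. -/
theorem energy_ne_top_of_mem_CcInfty {Ω : Set (E n)} (hQ : IsModularDensity (n := n) m Q)
    (hP : IsGagliardoKernel m P w) {φ : E n → ℝ} (hφ : φ ∈ CcInfty Ω) :
    energy Q P φ ≠ ⊤ := by
  obtain ⟨hsm, hcs, -⟩ := hφ
  obtain ⟨T, hT⟩ := hcs.exists_bound_of_continuous hsm.continuous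
  obtain ⟨L, hL⟩ := hsm.lipschitzWith_of_hasCompactSupport hcs (by simp)
  have hint : Integrable φ := hsm.continuous.integrable_of_hasCompactSupport hcs
  have hT0 : 0 ≤ T := (norm_nonneg _).trans (hT 0)
  refine ENNReal.add_ne_top.2 ⟨?_, ?_⟩
  · obtain ⟨B, hB⟩ := hQ.le_linear T
    refine ne_top_of_le_ne_top ?_ (lintegral_mono fun x => hB (φ x) (hT x))
    rw [lintegral_const_mul' _ _ ENNReal.coe_ne_top]
    exact ENNReal.mul_ne_top ENNReal.coe_ne_top hint.hasFiniteIntegral.ne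
  · set L' : ℝ := max (2 * T) L
    have hL' : 0 ≤ L' := le_trans (by positivity) (le_max_left _ _)
    set g : E n → ℝ := (tsupport φ).indicator fun _ => L'
    have hg0 : ∀ x, 0 ≤ g x := indicator_nonneg fun _ _ => hL'
    have hgL : ∀ x, g x ≤ L' := fun x => indicator_le_self' (fun _ _ => hL') x
    have hgm : Measurable g := measurable_const.indicator (isClosed_tsupport φ).measurableSet
    have hgi : ∫⁻ x, ‖g x‖ₑ ≠ ⊤ := by
      have : Integrable g := (integrable_indicator_iff (isClosed_tsupport φ).measurableSet).2
        (integrableOn_const hcs.measure_lt_top.ne)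
      exact this.hasFiniteIntegral.ne
    obtain ⟨A, hA⟩ := hP.le_weight (L' + L')
    have hinc : ∀ y z, |φ (y + z) - φ y| ≤ (g y + g (y + z)) * min 1 ‖z‖ := by
      intro y z
      have h1 : |φ (y + z) - φ y| ≤ L' * min 1 ‖z‖ := by
        rcases le_total 1 ‖z‖ with h | h
        · rw [min_eq_left h, mul_one]
          refine le_trans ?_ (le_max_left _ _)
          rw [two_mul]
          exact (abs_sub _ _).trans (add_le_add (hT _) (hT _))
        · rw [min_eq_right h]
          have := hL.dist_le_mul (y + z) y
          rw [Real.dist_eq, dist_self_add_left] at this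
          exact this.trans (mul_le_mul_of_nonneg_right (le_max_right _ _) (norm_nonneg _))
      have hmin : 0 ≤ min 1 ‖z‖ := le_min zero_le_one (norm_nonneg _)
      by_cases hy : y ∈ tsupport φ
      · refine h1.trans (mul_le_mul_of_nonneg_right ?_ hmin)
        rw [show g y = L' from indicator_of_mem hy _]
        linarith [hg0 (y + z)]
      by_cases hyz : y + z ∈ tsupport φ
      · refine h1.trans (mul_le_mul_of_nonneg_right ?_ hmin)
        rw [show g (y + z) = L' from indicator_of_mem hyz _]
        linarith [hg0 y]
      · rw [image_eq_zero_of_notMem_tsupport hy, image_eq_zero_of_notMem_tsupport hyz, sub_zero,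
          abs_zero]
        exact mul_nonneg (add_nonneg (hg0 _) (hg0 _)) hmin
    have hslice : ∀ z, incrementModular P φ z ≤
        A * ((∫⁻ x, ‖g x‖ₑ) + ∫⁻ x, ‖g x‖ₑ) * w z := by
      intro z
      have hm : Measurable fun x => ‖g x‖ₑ := hgm.enorm
      calc incrementModular P φ z
          ≤ ∫⁻ y, A * (‖g y‖ₑ + ‖g (y + z)‖ₑ) * w z := by
            refine lintegral_mono fun y => (hA z _ (g y + g (y + z)) ?_ ?_).trans ?_
            · rw [abs_of_nonneg (add_nonneg (hg0 _) (hg0 _))]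
              exact add_le_add (hgL _) (hgL _)
            · rw [abs_of_nonneg (add_nonneg (hg0 _) (hg0 _))]
              exact hinc y z
            · gcongr
              exact enorm_add_le _ _
        _ = _ := by
            have hm2 : Measurable fun y => (A : ℝ≥0∞) * (‖g y‖ₑ + ‖g (y + z)‖ₑ) :=
              (hm.add (hm.comp (measurable_add_const z))).const_mul _
            rw [lintegral_mul_const _ hm2,
              lintegral_const_mul' _ _ ENNReal.coe_ne_top, lintegral_add_left hm,
              lintegral_add_right_eq_self (fun x => ‖g x‖ₑ) z]
    refine ne_top_of_le_ne_top ?_ (lintegral_mono hslice)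
    rw [lintegral_const_mul _ hP.measurable_weight]
    exact ENNReal.mul_ne_top (ENNReal.mul_ne_top ENNReal.coe_ne_top
      (ENNReal.add_ne_top.2 ⟨hgi, hgi⟩)) hP.lintegral_weight

/-! ### Scaling -/

/-- The maximum with 1 is there because the growth bound concerns factors at least 1; for larger
`lam`, monotonicity suffices. -/
theorem IsModularDensity.div_le {ρ : ℝ → ℝ≥0∞} (hρ : IsModularDensity (n := n) m ρ) {lam : ℝ}
    (hlam : 0 < lam) (t : ℝ) :
    ρ (t / lam) ≤ ENNReal.ofReal ((max 1 lam⁻¹) ^ m) * ρ t := by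
  refine (hρ.mono _ (max 1 lam⁻¹ * t) ?_).trans (hρ.scale _ _ (le_max_left _ _))
  rw [div_eq_inv_mul, abs_mul, abs_mul, abs_of_pos (inv_pos.2 hlam),
    abs_of_nonneg (zero_le_one.trans (le_max_left 1 lam⁻¹))]
  exact mul_le_mul_of_nonneg_right (le_max_right _ _) (abs_nonneg _)

theorem IsModularDensity.lintegral_div_le (hQ : IsModularDensity (n := n) m Q) {lam : ℝ}
    (hlam : 0 < lam) (v : E n → ℝ) :
    ∫⁻ x, Q (v x / lam) ≤ ENNReal.ofReal ((max 1 lam⁻¹) ^ m) * ∫⁻ x, Q (v x) := by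
  rw [← lintegral_const_mul' _ _ ENNReal.ofReal_ne_top]
  exact lintegral_mono fun x => hQ.div_le hlam (v x)

theorem IsGagliardoKernel.lintegral_div_le (hP : IsGagliardoKernel m P w) {lam : ℝ}
    (hlam : 0 < lam) (v : E n → ℝ) :
    ∫⁻ z, incrementModular P (fun x => v x / lam) z ≤
      ENNReal.ofReal ((max 1 lam⁻¹) ^ m) * ∫⁻ z, incrementModular P v z := by
  rw [← lintegral_const_mul' _ _ ENNReal.ofReal_ne_top]
  refine lintegral_mono fun z => ?_
  rw [incrementModular, incrementModular, ← lintegral_const_mul' _ _ ENNReal.ofReal_ne_top]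
  refine lintegral_mono fun y => ?_
  simp only
  rw [← sub_div]
  exact (hP.density z).div_le hlam _

/-! ### The modulars of the Musielak–Sobolev space -/

variable {a : E n → E n → ℝ → ℝ} {s : ℝ}

theorem modular_eq (hH2 : CondH2 a) (v : E n → ℝ) :
    modular a v = ∫⁻ x, ENNReal.ofReal (G a 0 0 |v x|) := by
  refine lintegral_congr fun x => ?_
  rw [Ghat, G_eq_G_sub hH2 _ _ (abs_nonneg _), sub_self]

/-- This is the change of variables $(x,y)\mapsto(x-y,y)$, with $(H_2)$ making the kernel a function
of $x-y$. -/
theorem fracModular_eq (hH2 : CondH2 a)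
    (hP : IsGagliardoKernel m (gagliardoKernel (fun z => G a z 0) s) w) (hv : Measurable v) :
    fracModular a s v = ∫⁻ z, incrementModular (gagliardoKernel (fun z => G a z 0) s) v z := by
  have hmeas := hP.aemeasurable_prod hv
  have hmp := measurePreserving_sub_prod (volume : Measure (E n)) (volume : Measure (E n))
  unfold incrementModular
  rw [← lintegral_prod _ hmeas, ← hmp.map_eq, lintegral_map' (by rwa [hmp.map_eq])
    hmp.measurable.aemeasurable]
  refine lintegral_congr fun p => ?_
  rw [G_eq_G_sub hH2 _ _ (by positivity)]
  simp [gagliardoKernel]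

theorem modular_congr (h : u =ᵐ[volume] v) : modular a u = modular a v :=
  lintegral_congr_ae (h.mono fun x hx => by simp only [hx])

theorem fracModular_congr (h : u =ᵐ[volume] v) : fracModular a s u = fracModular a s v := by
  refine lintegral_congr_ae ?_
  filter_upwards [Measure.quasiMeasurePreserving_fst.ae (μb := (volume : Measure (E n)))
    (μa := (volume : Measure (E n)).prod (volume : Measure (E n))) h,
    Measure.quasiMeasurePreserving_snd.ae (μb := (volume : Measure (E n)))
    (μa := (volume : Measure (E n)).prod (volume : Measure (E n))) h] with p h1 h2
  rw [h1, h2]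

theorem luxemburg_le {J : (E n → ℝ) → ℝ≥0∞} {lam : ℝ} (hlam : 0 < lam)
    (h : J (fun x => u x / lam) ≤ 1) : luxemburg J u ≤ ENNReal.ofReal lam :=
  iInf₂_le lam ⟨hlam, h⟩

end MusielakSobolev

/-! ### The density theorem -/

open MusielakSobolev in
theorem theorem2 (n : ℕ) (s : ℝ) (hs : s ∈ Set.Ioo (0 : ℝ) 1)
    (a : MusielakSobolev.E n → MusielakSobolev.E n → ℝ → ℝ)
    (ha : MusielakSobolev.Nonneg a) (hG : MusielakSobolev.Caratheodory a)
    (hg1 : MusielakSobolev.CondG1 a) (hg2 : MusielakSobolev.CondG2 a)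
    (hg3 : MusielakSobolev.CondG3 a) (hg4 : MusielakSobolev.CondG4 a)
    (hH1 : MusielakSobolev.CondH1 a) (hH2 : MusielakSobolev.CondH2 a)
    (hBf : MusielakSobolev.CondBf a)
    (Ω : Set (MusielakSobolev.E n)) (hΩ : IsOpen Ω)
    (hbd : MusielakSobolev.HasContinuousBoundary Ω) :
    MusielakSobolev.CcInfty Ω ⊆ MusielakSobolev.W0Space a s Ω ∧
    ∀ u ∈ MusielakSobolev.W0Space a s Ω, ∀ ε : ℝ, 0 < ε →
      ∃ φ ∈ MusielakSobolev.CcInfty Ω,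
        MusielakSobolev.sobolevNorm a s (fun x => u x - φ x) < ENNReal.ofReal ε := by
  obtain ⟨m, C, hK⟩ := exists_isYoungFamily ha hG hg2 hg3 hg4 hH2 hBf
  have hP := hK.isGagliardoKernel hs
  set P := gagliardoKernel (fun z => G a z 0) s
  set Q : ℝ → ℝ≥0∞ := fun t => ENNReal.ofReal (G a 0 0 |t|) with hQdef
  have hQ : IsModularDensity (n := n) m Q := by
    simpa [hQdef] using hK.isModularDensity 0 zero_le_one zero_le_one
  have hQpos : ∀ t, t ≠ 0 → Q t ≠ 0 := fun t ht =>
    (ENNReal.ofReal_pos.2 (hK.pos 0 _ (abs_pos.2 ht))).ne'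
  have hJ : ∀ v, modular a v = ∫⁻ x, Q (v x) := modular_eq hH2
  have hJs : ∀ v, Measurable v → fracModular a s v = ∫⁻ z, incrementModular P v z :=
    fun v hv => fracModular_eq hH2 hP hv
  constructor
  · intro φ hφ
    have hm := measurable_of_mem_CcInfty hφ
    have hE := energy_ne_top_of_mem_CcInfty hQ hP hφ
    rw [energy, ENNReal.add_ne_top] at hE
    refine ⟨⟨⟨hm.aemeasurable, 1, one_pos, ?_⟩, 1, one_pos, ?_⟩, ae_of_all _ fun x hx =>
      image_eq_zero_of_notMem_tsupport fun h => hx (hφ.2.2 h)⟩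
    · simp only [one_mul]
      rw [hJ]
      exact hE.1.lt_top
    · simp only [one_mul]
      rw [hJs φ hm]
      exact hE.2.lt_top
  · rintro u ⟨⟨⟨hum, lam, hlam, hlamJ⟩, lam', hlam', hlamJs⟩, huΩ⟩ ε hε
    -- A measurable representative vanishing everywhere outside $\Omega$; the modulars do not see
    -- the null set of change.
    set v : E n → ℝ := Ω.indicator (hum.mk u)
    have hv : Measurable v := hum.measurable_mk.indicator hΩ.measurableSet
    have huv : u =ᵐ[volume] v := by
      filter_upwards [hum.ae_eq_mk, huΩ] with x h1 h2
      by_cases hx : x ∈ Ω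
      · rw [h1]; exact (indicator_of_mem hx _).symm
      · rw [h2 hx]; exact (indicator_of_notMem hx _).symm
    have hvΩ : ∀ x ∉ Ω, v x = 0 := fun x hx => indicator_of_notMem hx _
    -- Membership gives finite modulars only for some multiples of $u$; polynomial growth transfers
    -- this to $v$ itself.
    have hE : energy Q P v ≠ ⊤ := by
      refine ENNReal.add_ne_top.2 ⟨?_, ?_⟩
      · have h := hQ.lintegral_div_le hlam fun x => lam * v x
        simp only [mul_div_cancel_left₀ _ hlam.ne'] at h
        refine ne_top_of_le_ne_top (ENNReal.mul_ne_top ENNReal.ofReal_ne_top ?_) h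
        rw [← hJ, ← modular_congr (u := fun x => lam * u x)
          (huv.mono fun x hx => by simp only [hx])]
        exact hlamJ.ne
      · have h := hP.lintegral_div_le hlam' fun x => lam' * v x
        simp only [mul_div_cancel_left₀ _ hlam'.ne'] at h
        refine ne_top_of_le_ne_top (ENNReal.mul_ne_top ENNReal.ofReal_ne_top ?_) h
        rw [← hJs _ (hv.const_mul _), ← fracModular_congr (u := fun x => lam' * u x)
          (huv.mono fun x hx => by simp only [hx])]
        exact hlamJs.ne
    -- Two terms of size $\varepsilon/3$ leave the inequality strict. The constant `c` is the cost
    -- of dividing by $\varepsilon/3$, so energy at most $c^{-1}$ brings both scaled modulars below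
    -- 1.
    have hε3 : 0 < ε / 3 := by positivity
    set c : ℝ≥0∞ := ENNReal.ofReal ((max 1 (ε / 3)⁻¹) ^ m)
    have hc0 : c ≠ 0 := (ENNReal.ofReal_pos.2 (by positivity)).ne'
    have hc : c ≠ ⊤ := ENNReal.ofReal_ne_top
    obtain ⟨φ, hφ, hφv⟩ := isSmoothLimit_of_energy_ne_top hΩ hbd hQ hQpos hP hv hvΩ hE c⁻¹
      (ENNReal.inv_ne_zero.2 hc)
    have hφm := measurable_of_mem_CcInfty hφ
    refine ⟨φ, hφ, ?_⟩
    have hae : (fun x => (u x - φ x) / (ε / 3)) =ᵐ[volume] fun x => (v - φ) x / (ε / 3) :=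
      huv.mono fun x hx => by simp only [hx, Pi.sub_apply]
    have h1 : luxemburg (modular a) (fun x => u x - φ x) ≤ ENNReal.ofReal (ε / 3) := by
      refine luxemburg_le hε3 ?_
      rw [modular_congr hae, hJ]
      refine (hQ.lintegral_div_le hε3 _).trans ?_
      rw [← ENNReal.mul_inv_cancel hc0 hc]
      exact mul_le_mul_right (le_self_add.trans hφv) _
    have h2 : luxemburg (fracModular a s) (fun x => u x - φ x) ≤ ENNReal.ofReal (ε / 3) := by
      refine luxemburg_le hε3 ?_
      rw [fracModular_congr hae, hJs _ ((hv.sub hφm).div_const _)]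
      refine (hP.lintegral_div_le hε3 _).trans ?_
      rw [← ENNReal.mul_inv_cancel hc0 hc]
      exact mul_le_mul_right (le_add_self.trans hφv) _
    calc sobolevNorm a s (fun x => u x - φ x)
        ≤ ENNReal.ofReal (ε / 3) + ENNReal.ofReal (ε / 3) := add_le_add h1 h2
      _ = ENNReal.ofReal (ε / 3 + ε / 3) := (ENNReal.ofReal_add hε3.le hε3.le).symm
      _ < ENNReal.ofReal ε := (ENNReal.ofReal_lt_ofReal_iff hε).2 (by linarith)
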